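/- Let $M=\mathrm{CW}_5$ be the 5-dimensional conformally flat Cahen–Wallach space, that is $\mathbb{R}^5$ with global coordinates $(x^+,x^-,x^1,x^2,x^3)$ and the lorentzian metric $$g = 2\,dx^+dx^- + |x|^2 (dx^-)^2 + |dx|^2,\qquad |x|^2=\sum_{i=1}^3 (x^i)^2,\quad |dx|^2=\sum_{i=1}^3 (dx^i)^2 .$$ Let $\mathfrak g\rtimes\mathfrak{so}(3)$ be the real Lie algebra with basis $e_-,e_+,e_i,e_i^*,V_i$ ($i=1,2,3$) and non-trivial brackets $$[e_-,e_i]=e_i^*,\quad [e_-,e_i^*]=e_i,\quad [e_i^*,e_j]=\delta_{ij}e_+,\quad [V_i,V_j]=-\epsilon_{ijk}V_k,\quad [V_i,e_j]=-\epsilon_{ijk}e_k,\quad [V_i,e_j^*]=-\epsilon_{ijk}e_k^* .$$ Associate with each $X\in\mathfrak g\rtimes\mathfrak{so}(3)$ the vector field $\xi_X$ on $M$ that depends linearly on $X$ and is given on the basis by $$\xi_{e_\pm}=\partial_\pm,\quad \xi_{e_i}=\cosh(x^-)\,\partial_i-\sinh(x^-)\,x^i\,\partial_+,\quad \xi_{e_i^*}=\cosh(x^-)\,x^i\,\partial_+-\sinh(x^-)\,\partial_i,$$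 $$\xi_{V_1}=R_{23},\quad \xi_{V_2}=R_{31},\quad \xi_{V_3}=R_{12},\qquad R_{jk}=x^j\partial_k-x^k\partial_j .$$ **Proposition 5.1.** Let $\xi$ be a (smooth) Killing vector field of $M$ whose norm never vanishes, i.e. $g(\xi,\xi)\neq 0$ at every point of $M$. Then there are an isometry $\varphi$ of $M$ and a real number $r\neq 0$ such that $\varphi_*\xi=r\,\xi_X$, where $X$ is one of the following elements of $\mathfrak g\rtimes\mathfrak{so}(3)$ (all parameters are real and arbitrary unless restricted): $$\begin{aligned} X_1&=e_-+b\,V_3+\gamma\, e_+, && \gamma>0,\\ X_2&=V_3+c\,e_3, && c\neq 0,\\ X_4^\pm&=V_3+c\,(e_3\pm e_3^*), && c\neq 0,\\ X_6&=e_3,\\ X_8^\pm&=e_3\pm e_3^*,\\ X_9&=e_3+d_3\,e_3^*+d_1\,e_1^*, && d_1\neq 0. \end{aligned}$$ Conversely, for each of these elements $X$ the vector field $\xi_X$ is Killing and spacelike: $g(\xi_X,\xi_X)>0$ at every point of $M$. -/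

import Mathlib

open scoped ContDiff Matrix

namespace CW

/-! ### The space and its metric -/

/-- The manifold `ℝ⁵` with its global coordinates `(x⁺, x⁻, (x¹, x², x³))`. The indices `1, 2, 3`
are the elements `0, 1, 2` of `Fin 3`. Since there is one global chart, the same type is used for
the tangent space at each point, and a vector field is a map `CW5 → CW5`. -/
abbrev CW5 : Type := ℝ × ℝ × (Fin 3 → ℝ)

/-- The coordinate vector `∂₊`. -/
def dPlus : CW5 := (1, 0, 0)

/-- The coordinate vector `∂₋`. -/
def dMinus : CW5 := (0, 1, 0)

/-- The coordinate vectors `∂ᵢ`. -/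
def dSpace (i : Fin 3) : CW5 := (0, 0, Pi.single i 1)

/-- The metric `g = 2 dx⁺ dx⁻ + |x|² (dx⁻)² + |dx|²` at the point `p`, applied to `u` and `v`. -/
def metric (p u v : CW5) : ℝ :=
  (u.1 * v.2.1 + u.2.1 * v.1) + (∑ i, p.2.2 i ^ 2) * (u.2.1 * v.2.1) + ∑ i, u.2.2 i * v.2.2 i

/-- The Lie derivative `L_ξ g` at `p`, applied to `u` and `v`: for constant `u`, `v` one has
`(L_ξ g)(u, v) = ξ(g(u, v)) - g([ξ, u], v) - g(u, [ξ, v])` with `[ξ, u] = -Dξ(u)`. -/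
noncomputable def lieDerivMetric (ξ : CW5 → CW5) (p u v : CW5) : ℝ :=
  fderiv ℝ (fun q => metric q u v) p (ξ p)
    + metric p (fderiv ℝ ξ p u) v + metric p u (fderiv ℝ ξ p v)

/-- Killing vector fields: smooth vector fields `ξ` with `L_ξ g = 0`. -/
def IsKilling (ξ : CW5 → CW5) : Prop :=
  ContDiff ℝ ∞ ξ ∧ ∀ p u v : CW5, lieDerivMetric ξ p u v = 0

/-- Isometries: diffeomorphisms `φ` with `φ^* g = g`. -/
def IsIsometry (φ : CW5 ≃ CW5) : Prop :=
  ContDiff ℝ ∞ φ ∧ ContDiff ℝ ∞ φ.symm ∧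
    ∀ p u v : CW5, metric (φ p) (fderiv ℝ φ p u) (fderiv ℝ φ p v) = metric p u v

/-- The push-forward `φ_* ξ` of a vector field. -/
noncomputable def pushforward (φ : CW5 ≃ CW5) (ξ : CW5 → CW5) : CW5 → CW5 :=
  fun q => fderiv ℝ φ (φ.symm q) (ξ (φ.symm q))

/-! ### The Lie algebra `𝔤 ⋊ 𝔰𝔬(3)` -/

/-- The real Lie algebra `𝔤 ⋊ 𝔰𝔬(3)` in coordinates:
`⟨α, γ, c, d, b⟩` is `α e₋ + γ e₊ + ∑ cᵢ eᵢ + ∑ dᵢ eᵢ^* + ∑ bᵢ Vᵢ`. -/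
@[ext]
structure Alg : Type where
  minus : ℝ
  plus : ℝ
  cE : Fin 3 → ℝ
  cEs : Fin 3 → ℝ
  cV : Fin 3 → ℝ

namespace Alg

instance : Zero Alg := ⟨⟨0, 0, 0, 0, 0⟩⟩
instance : Add Alg :=
  ⟨fun X Y => ⟨X.minus + Y.minus, X.plus + Y.plus, X.cE + Y.cE, X.cEs + Y.cEs, X.cV + Y.cV⟩⟩
instance : Neg Alg := ⟨fun X => ⟨-X.minus, -X.plus, -X.cE, -X.cEs, -X.cV⟩⟩
instance : SMul ℝ Alg :=
  ⟨fun r X => ⟨r * X.minus, r * X.plus, r • X.cE, r • X.cEs, r • X.cV⟩⟩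

/-- The bracket with `[e₋, eᵢ] = eᵢ^*`, `[e₋, eᵢ^*] = eᵢ`, `[eᵢ^*, eⱼ] = δᵢⱼ e₊`,
`[Vᵢ, Vⱼ] = -εᵢⱼₖ Vₖ`, `[Vᵢ, eⱼ] = -εᵢⱼₖ eₖ`, `[Vᵢ, eⱼ^*] = -εᵢⱼₖ eₖ^*`, `[Vᵢ, e₊] = [Vᵢ, e₋] = 0`,
and all other brackets of generators zero. -/
instance : Bracket Alg Alg :=
  ⟨fun X Y =>
    { minus := 0
      plus := X.cEs ⬝ᵥ Y.cE - X.cE ⬝ᵥ Y.cEs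
      cE := X.minus • Y.cEs - Y.minus • X.cEs - X.cV ⨯₃ Y.cE + Y.cV ⨯₃ X.cE
      cEs := X.minus • Y.cE - Y.minus • X.cE - X.cV ⨯₃ Y.cEs + Y.cV ⨯₃ X.cEs
      cV := -(X.cV ⨯₃ Y.cV) }⟩

@[simp] theorem zero_minus : (0 : Alg).minus = 0 := rfl
@[simp] theorem zero_plus : (0 : Alg).plus = 0 := rfl
@[simp] theorem zero_cE : (0 : Alg).cE = 0 := rfl
@[simp] theorem zero_cEs : (0 : Alg).cEs = 0 := rfl
@[simp] theorem zero_cV : (0 : Alg).cV = 0 := rfl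
@[simp] theorem add_minus (X Y : Alg) : (X + Y).minus = X.minus + Y.minus := rfl
@[simp] theorem add_plus (X Y : Alg) : (X + Y).plus = X.plus + Y.plus := rfl
@[simp] theorem add_cE (X Y : Alg) : (X + Y).cE = X.cE + Y.cE := rfl
@[simp] theorem add_cEs (X Y : Alg) : (X + Y).cEs = X.cEs + Y.cEs := rfl
@[simp] theorem add_cV (X Y : Alg) : (X + Y).cV = X.cV + Y.cV := rfl
@[simp] theorem neg_minus (X : Alg) : (-X).minus = -X.minus := rfl
@[simp] theorem neg_plus (X : Alg) : (-X).plus = -X.plus := rfl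
@[simp] theorem neg_cE (X : Alg) : (-X).cE = -X.cE := rfl
@[simp] theorem neg_cEs (X : Alg) : (-X).cEs = -X.cEs := rfl
@[simp] theorem neg_cV (X : Alg) : (-X).cV = -X.cV := rfl
@[simp] theorem smul_minus (r : ℝ) (X : Alg) : (r • X).minus = r * X.minus := rfl
@[simp] theorem smul_plus (r : ℝ) (X : Alg) : (r • X).plus = r * X.plus := rfl
@[simp] theorem smul_cE (r : ℝ) (X : Alg) : (r • X).cE = r • X.cE := rfl
@[simp] theorem smul_cEs (r : ℝ) (X : Alg) : (r • X).cEs = r • X.cEs := rfl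
@[simp] theorem smul_cV (r : ℝ) (X : Alg) : (r • X).cV = r • X.cV := rfl
@[simp] theorem bracket_minus (X Y : Alg) : ⁅X, Y⁆.minus = 0 := rfl
@[simp] theorem bracket_plus (X Y : Alg) :
    ⁅X, Y⁆.plus = X.cEs ⬝ᵥ Y.cE - X.cE ⬝ᵥ Y.cEs := rfl
@[simp] theorem bracket_cE (X Y : Alg) :
    ⁅X, Y⁆.cE = X.minus • Y.cEs - Y.minus • X.cEs - X.cV ⨯₃ Y.cE + Y.cV ⨯₃ X.cE := rfl
@[simp] theorem bracket_cEs (X Y : Alg) :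
    ⁅X, Y⁆.cEs = X.minus • Y.cE - Y.minus • X.cE - X.cV ⨯₃ Y.cEs + Y.cV ⨯₃ X.cEs := rfl
@[simp] theorem bracket_cV (X Y : Alg) : ⁅X, Y⁆.cV = -(X.cV ⨯₃ Y.cV) := rfl

instance : AddCommGroup Alg where
  add_assoc X Y Z := by ext <;> simp [add_assoc]
  zero_add X := by ext <;> simp
  add_zero X := by ext <;> simp
  neg_add_cancel X := by ext <;> simp
  add_comm X Y := by ext <;> simp [add_comm]
  nsmul := nsmulRec
  zsmul := zsmulRec

noncomputable instance : Module ℝ Alg where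
  one_smul X := by ext <;> simp
  mul_smul r s X := by ext <;> simp [mul_assoc]
  smul_zero r := by ext <;> simp
  smul_add r X Y := by ext <;> simp [mul_add]
  add_smul r s X := by ext <;> simp [add_mul]
  zero_smul X := by ext <;> simp

noncomputable instance : LieRing Alg where
  add_lie X Y Z := by
    apply Alg.ext
    · simp
    · simp; ring
    · simp [add_smul]; abel
    · simp [add_smul]; abel
    · simp [add_comm]
  lie_add X Y Z := by
    apply Alg.ext
    · simp
    · simp; ring
    · simp [add_smul]; abel
    · simp [add_smul]; abel
    · simp [add_comm]
  lie_self X := by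
    apply Alg.ext
    · simp
    · simp [dotProduct_comm]
    · simp
    · simp
    · simp
  leibniz_lie X Y Z := by
    apply Alg.ext
    · simp
    · simp [dotProduct, Fin.sum_univ_three, cross_apply, Matrix.vecHead, Matrix.vecTail]; ring
    · ext i; fin_cases i <;> simp [cross_apply, Matrix.vecHead, Matrix.vecTail] <;> ring
    · ext i; fin_cases i <;> simp [cross_apply, Matrix.vecHead, Matrix.vecTail] <;> ring
    · ext i; fin_cases i <;> simp [cross_apply] <;> ring

noncomputable instance : LieAlgebra ℝ Alg where
  lie_smul r X Y := by
    apply Alg.ext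
    · simp
    · simp; ring
    · ext i; fin_cases i <;> simp [cross_apply, Matrix.vecHead, Matrix.vecTail] <;> ring
    · ext i; fin_cases i <;> simp [cross_apply, Matrix.vecHead, Matrix.vecTail] <;> ring
    · ext i; fin_cases i <;> simp [cross_apply] <;> ring

end Alg

/-- The generator `e₋`. -/
def eMinus : Alg := ⟨1, 0, 0, 0, 0⟩

/-- The generator `e₊`. -/
def ePlus : Alg := ⟨0, 1, 0, 0, 0⟩

/-- The generators `eᵢ`. -/
def e (i : Fin 3) : Alg := ⟨0, 0, Pi.single i 1, 0, 0⟩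

/-- The generators `eᵢ^*`. -/
def eStar (i : Fin 3) : Alg := ⟨0, 0, 0, Pi.single i 1, 0⟩

/-- The generators `Vᵢ` of `𝔰𝔬(3)`. -/
def V (i : Fin 3) : Alg := ⟨0, 0, 0, 0, Pi.single i 1⟩

/-! ### The vector field associated with an element of the Lie algebra -/

/-- `ξ_{eᵢ} = cosh(x⁻) ∂ᵢ - sinh(x⁻) xⁱ ∂₊`. -/
noncomputable def fieldE (i : Fin 3) : CW5 → CW5 := fun p =>
  Real.cosh p.2.1 • dSpace i - (Real.sinh p.2.1 * p.2.2 i) • dPlus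

/-- `ξ_{eᵢ^*} = cosh(x⁻) xⁱ ∂₊ - sinh(x⁻) ∂ᵢ`. -/
noncomputable def fieldEStar (i : Fin 3) : CW5 → CW5 := fun p =>
  (Real.cosh p.2.1 * p.2.2 i) • dPlus - Real.sinh p.2.1 • dSpace i

/-- The rotation field `R_{jk} = xʲ ∂ₖ - xᵏ ∂ⱼ`. -/
noncomputable def rotField (j k : Fin 3) : CW5 → CW5 := fun p =>
  p.2.2 j • dSpace k - p.2.2 k • dSpace j

/-- The vector field `ξ_X` associated with `X`, by linear extension of `ξ_{e₋} = ∂₋`, `ξ_{e₊} = ∂₊`,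
the above formulas for `ξ_{eᵢ}` and `ξ_{eᵢ^*}`, and `ξ_{V₁} = R₂₃`, `ξ_{V₂} = R₃₁`, `ξ_{V₃} = R₁₂`
(the sums `i + 1` and `i + 2` in `Fin 3` are modulo `3`). -/
noncomputable def field (X : Alg) : CW5 → CW5 := fun p =>
  X.minus • dMinus + X.plus • dPlus + ∑ i, X.cE i • fieldE i p + ∑ i, X.cEs i • fieldEStar i p
    + ∑ i, X.cV i • rotField (i + 1) (i + 2) p

/-- The list of normal forms `X₁, X₂, X₄^±, X₆, X₈^±, X₉`. The generators with subscripts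
`1` and `3` have the arguments `0` and `2` in `Fin 3`. -/
inductive IsNormalForm : Alg → Prop
  | X1 (b γ : ℝ) (hγ : 0 < γ) : IsNormalForm (eMinus + b • V 2 + γ • ePlus)
  | X2 (c : ℝ) (hc : c ≠ 0) : IsNormalForm (V 2 + c • e 2)
  | X4plus (c : ℝ) (hc : c ≠ 0) : IsNormalForm (V 2 + c • (e 2 + eStar 2))
  | X4minus (c : ℝ) (hc : c ≠ 0) : IsNormalForm (V 2 + c • (e 2 - eStar 2))
  | X6 : IsNormalForm (e 2)
  | X8plus : IsNormalForm (e 2 + eStar 2)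
  | X8minus : IsNormalForm (e 2 - eStar 2)
  | X9 (d₃ d₁ : ℝ) (hd₁ : d₁ ≠ 0) : IsNormalForm (e 2 + d₃ • eStar 2 + d₁ • eStar 0)

end CW

namespace CW

/-! ### The Killing equation -/

/-! Write `wave c d t = cosh t • c - sinh t • d`. For X = (α, γ, c, d, b) the field ξ_X has
components γ + `wave d c x⁻`·x, α and `wave c d x⁻` + b × x. The proof has three pillars.

Every Killing field is some ξ_X (`IsKilling.exists_eq_field`). On a hyperplane x⁻ = t the metric
restricts to |dx|², so conservation of g(ξ, u) along its lines makes ξ⁻ and ξⁱ affine there.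
Comparing derivatives of ξ⁺ computed in two ways from the other Killing equations makes all
coefficients constant, except the translation part ω(x⁻), which solves ω'' = ω. Hence cosh and sinh
appear.

Isometries act on X: translations of x⁻ mix c and d hyperbolically (`related_boost`), rotations act
on c, d, b (`related_rotation`), and the Heisenberg group shifts γ, c, d (`related_heisenberg`).

The norm is 2α(γ + `wave d c`·x) + α²|x|² + |`wave c d` + b × x|². If α ≠ 0, scale to α = 1; the
Heisenberg group removes c and d, and the norm avoids zero only for γ > 0. If α = 0, the norm is the
square of the spatial part. For b ≠ 0 only the components of c and d along b survive; for b = 0 they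
are parallel or independent. In the parallel case d = kc, a zero of cosh t - k sinh t would be a
zero of the norm, so |k| ≤ 1, and |k| < 1 is boosted to k = 0. -/

theorem fderiv_apply_eq_of_line {F : CW5 → CW5} (hF : Differentiable ℝ F) {p u v : CW5}
    (h : HasDerivAt (fun s : ℝ => F (p + s • u)) v 0) : fderiv ℝ F p u = v := by
  have h1 : HasLineDerivAt ℝ F (fderiv ℝ F p u) p u := (hF p).hasFDerivAt.hasLineDerivAt u
  exact h1.unique h

theorem metric_eq (p u v : CW5) :
    metric p u v = (u.1 * v.2.1 + u.2.1 * v.1) + (p.2.2 ⬝ᵥ p.2.2) * (u.2.1 * v.2.1)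
      + u.2.2 ⬝ᵥ v.2.2 := by
  simp [metric, dotProduct, pow_two]

theorem lieDerivMetric_eq (ξ : CW5 → CW5) (p u v : CW5) :
    lieDerivMetric ξ p u v = 2 * (p.2.2 ⬝ᵥ (ξ p).2.2) * (u.2.1 * v.2.1)
      + metric p (fderiv ℝ ξ p u) v + metric p u (fderiv ℝ ξ p v) := by
  have hd : Differentiable ℝ (fun q : CW5 => metric q u v) := by
    unfold metric; fun_prop
  have key : fderiv ℝ (fun q => metric q u v) p (ξ p)
      = 2 * (p.2.2 ⬝ᵥ (ξ p).2.2) * (u.2.1 * v.2.1) := by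
    -- Only the coefficient |x|² of the metric depends on the point, so differentiation along the
    -- line p + s ξ(p) suffices.
    have h1 := (hd p).hasFDerivAt.hasLineDerivAt (ξ p)
    refine h1.unique ?_
    have hx : ∀ i, HasDerivAt (fun s : ℝ => p.2.2 i + s * (ξ p).2.2 i) ((ξ p).2.2 i) 0 := fun i => by
      simpa using ((hasDerivAt_id (0 : ℝ)).mul_const ((ξ p).2.2 i)).const_add (p.2.2 i)
    have h2 := (((HasDerivAt.fun_sum (u := Finset.univ) fun i _ => (hx i).fun_pow 2).mul_const
      (u.2.1 * v.2.1)).const_add (u.1 * v.2.1 + u.2.1 * v.1)).add_const (∑ i, u.2.2 i * v.2.2 i)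
    refine HasDerivAt.congr_deriv h2 ?_
    simp [dotProduct, Finset.mul_sum, mul_assoc]
  rw [lieDerivMetric, key]

/-! ### The fields `ξ_X` -/

/-- The function `cosh t c - sinh t d`. -/
noncomputable def wave (c d : Fin 3 → ℝ) (t : ℝ) : Fin 3 → ℝ :=
  Real.cosh t • c - Real.sinh t • d

theorem wave_apply (c d : Fin 3 → ℝ) (t : ℝ) (i : Fin 3) :
    wave c d t i = Real.cosh t * c i - Real.sinh t * d i := rfl

theorem hasDerivAt_wave (c d : Fin 3 → ℝ) (t : ℝ) (i : Fin 3) :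
    HasDerivAt (fun s => wave c d s i) (-wave d c t i) t := by
  simp only [wave_apply]
  refine (((Real.hasDerivAt_cosh t).mul_const (c i)).fun_sub
    ((Real.hasDerivAt_sinh t).mul_const (d i))).congr_deriv ?_
  ring

theorem field_apply (X : Alg) (p t : ℝ) (x : Fin 3 → ℝ) :
    field X (p, t, x) = (X.plus + wave X.cEs X.cE t ⬝ᵥ x, X.minus,
      wave X.cE X.cEs t + X.cV ⨯₃ x) := by
  refine Prod.ext ?_ (Prod.ext ?_ ?_)
  · simp [field, fieldE, fieldEStar, rotField, dPlus, dMinus, dSpace, Fin.sum_univ_three,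
      wave_apply, dotProduct]
    ring
  · simp [field, fieldE, fieldEStar, rotField, dPlus, dMinus, dSpace, Fin.sum_univ_three]
  · ext i
    fin_cases i <;>
    · simp [field, fieldE, fieldEStar, rotField, dPlus, dMinus, dSpace, Fin.sum_univ_three,
        wave_apply, cross_apply]
      ring

theorem contDiff_field (X : Alg) : ContDiff ℝ ∞ (field X) := by
  unfold field fieldE fieldEStar rotField
  have h1 : ∀ i : Fin 3, ContDiff ℝ ∞ (fun p : CW5 => p.2.2 i) := fun i => by fun_prop
  have hc : ContDiff ℝ ∞ (fun p : CW5 => Real.cosh p.2.1) :=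
    Real.contDiff_cosh.comp (by fun_prop)
  have hs : ContDiff ℝ ∞ (fun p : CW5 => Real.sinh p.2.1) :=
    Real.contDiff_sinh.comp (by fun_prop)
  fun_prop

theorem fderiv_field (X : Alg) (p t : ℝ) (x : Fin 3 → ℝ) (u : CW5) :
    fderiv ℝ (field X) (p, t, x) u =
      (wave X.cEs X.cE t ⬝ᵥ u.2.2 - u.2.1 * (wave X.cE X.cEs t ⬝ᵥ x), 0,
        -(u.2.1 • wave X.cEs X.cE t) + X.cV ⨯₃ u.2.2) := by
  refine fderiv_apply_eq_of_line ((contDiff_field X).differentiable (by simp)) ?_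
  obtain ⟨u₁, u₂, u₃⟩ := u
  have e : (fun s : ℝ => field X ((p, t, x) + s • ((u₁, u₂, u₃) : CW5))) = fun s =>
      (X.plus + wave X.cEs X.cE (t + s * u₂) ⬝ᵥ (x + s • u₃), X.minus,
        wave X.cE X.cEs (t + s * u₂) + X.cV ⨯₃ (x + s • u₃)) := by
    funext s
    simp [field_apply]
  rw [e]
  have ht : HasDerivAt (fun s : ℝ => t + s * u₂) u₂ 0 := by
    simpa using ((hasDerivAt_id (0 : ℝ)).mul_const u₂).const_add t
  have hw : ∀ (c d : Fin 3 → ℝ) i, HasDerivAt (fun s : ℝ => wave c d (t + s * u₂) i)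
      (-wave d c t i * u₂) 0 := fun c d i => by
    have h := hasDerivAt_wave c d (t + 0 * u₂) i
    have h' := h.comp (0 : ℝ) ht
    rw [zero_mul, add_zero] at h'
    exact h'
  have hx : ∀ i, HasDerivAt (fun s : ℝ => x i + s * u₃ i) (u₃ i) 0 := fun i => by
    simpa using ((hasDerivAt_id (0 : ℝ)).mul_const (u₃ i)).const_add (x i)
  refine HasDerivAt.prodMk ?_ (HasDerivAt.prodMk (hasDerivAt_const _ _) (hasDerivAt_pi.2 fun i => ?_))
  · have h := (HasDerivAt.fun_sum (u := Finset.univ) fun i _ =>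
      (hw X.cEs X.cE i).fun_mul (hx i)).const_add X.plus
    refine HasDerivAt.congr_deriv h ?_
    simp [dotProduct, Fin.sum_univ_three]
    ring
  · have hcr : HasDerivAt (fun s : ℝ => (X.cV ⨯₃ (x + s • u₃)) i) ((X.cV ⨯₃ u₃) i) 0 := by
      have := ((hasDerivAt_id (0 : ℝ)).mul_const ((X.cV ⨯₃ u₃) i)).const_add ((X.cV ⨯₃ x) i)
      simpa [map_add, map_smul] using this
    refine ((hw X.cE X.cEs i).fun_add hcr).congr_deriv ?_
    simp [mul_comm]

theorem isKilling_field (X : Alg) : IsKilling (field X) := by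
  refine ⟨contDiff_field X, ?_⟩
  rintro ⟨p, t, x⟩ u v
  rw [lieDerivMetric_eq, fderiv_field, fderiv_field, field_apply, metric_eq, metric_eq]
  simp [dotProduct, Fin.sum_univ_three, cross_apply]
  ring

/-! ### Classification of Killing fields -/

theorem hasDerivAt_line {ξ : CW5 → CW5} (hξ : Differentiable ℝ ξ) (q u : CW5) (s : ℝ) :
    HasDerivAt (fun s : ℝ => ξ (q + s • u)) (fderiv ℝ ξ (q + s • u) u) s := by
  have h : HasDerivAt (fun s : ℝ => q + s • u) u s := by
    simpa using ((hasDerivAt_id s).smul_const u).const_add q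
  exact (hξ (q + s • u)).hasFDerivAt.comp_hasDerivAt s h

theorem hasDerivAt_fst {f : ℝ → CW5} {f' : CW5} {s : ℝ} (h : HasDerivAt f f' s) :
    HasDerivAt (fun s => (f s).1) f'.1 s :=
  (ContinuousLinearMap.fst ℝ ℝ (ℝ × (Fin 3 → ℝ))).hasFDerivAt.comp_hasDerivAt s h

theorem hasDerivAt_snd {f : ℝ → CW5} {f' : CW5} {s : ℝ} (h : HasDerivAt f f' s) :
    HasDerivAt (fun s => (f s).2) f'.2 s :=
  (ContinuousLinearMap.snd ℝ ℝ (ℝ × (Fin 3 → ℝ))).hasFDerivAt.comp_hasDerivAt s h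

theorem hasDerivAt_minus {f : ℝ → CW5} {f' : CW5} {s : ℝ} (h : HasDerivAt f f' s) :
    HasDerivAt (fun s => (f s).2.1) f'.2.1 s :=
  (ContinuousLinearMap.fst ℝ ℝ (Fin 3 → ℝ)).hasFDerivAt.comp_hasDerivAt s (hasDerivAt_snd h)

theorem hasDerivAt_space {f : ℝ → CW5} {f' : CW5} {s : ℝ} (h : HasDerivAt f f' s) (i : Fin 3) :
    HasDerivAt (fun s => (f s).2.2 i) (f'.2.2 i) s :=
  hasDerivAt_pi.1 ((ContinuousLinearMap.snd ℝ ℝ (Fin 3 → ℝ)).hasFDerivAt.comp_hasDerivAt s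
    (hasDerivAt_snd h)) i

theorem eq_of_hasDerivAt_zero {f : ℝ → ℝ} (h : ∀ s, HasDerivAt f 0 s) (a b : ℝ) : f a = f b :=
  is_const_of_deriv_eq_zero (fun s => (h s).differentiableAt) (fun s => (h s).deriv) a b

theorem eq_add_mul_of_hasDerivAt_const {f : ℝ → ℝ} {k : ℝ} (h : ∀ s, HasDerivAt f k s) (s : ℝ) :
    f s = f 0 + s * k := by
  have h1 : ∀ s, HasDerivAt (fun s => f s - s * k) 0 s := fun s =>
    ((h s).fun_sub ((hasDerivAt_id s).mul_const k)).congr_deriv (by simp)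
  have := eq_of_hasDerivAt_zero h1 s 0
  simp at this
  linarith

/-- The system `f' = g`, `g' = f` is solved by hyperbolic functions. -/
theorem eq_cosh_add_sinh {f g : ℝ → ℝ} (hf : ∀ t, HasDerivAt f (g t) t)
    (hg : ∀ t, HasDerivAt g (f t) t) (t : ℝ) :
    f t = Real.cosh t * f 0 + Real.sinh t * g 0 ∧
      g t = Real.sinh t * f 0 + Real.cosh t * g 0 := by
  have h1 : ∀ t, HasDerivAt (fun t => Real.cosh t * f t - Real.sinh t * g t) 0 t := fun t =>
    (((Real.hasDerivAt_cosh t).fun_mul (hf t)).fun_sub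
      ((Real.hasDerivAt_sinh t).fun_mul (hg t))).congr_deriv (by ring)
  have h2 : ∀ t, HasDerivAt (fun t => Real.cosh t * g t - Real.sinh t * f t) 0 t := fun t =>
    (((Real.hasDerivAt_cosh t).fun_mul (hg t)).fun_sub
      ((Real.hasDerivAt_sinh t).fun_mul (hf t))).congr_deriv (by ring)
  have e1 := eq_of_hasDerivAt_zero h1 t 0
  have e2 := eq_of_hasDerivAt_zero h2 t 0
  have e3 := Real.cosh_sq t
  simp at e1 e2
  constructor
  · linear_combination Real.cosh t * e1 + Real.sinh t * e2 - f t * e3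
  · linear_combination Real.sinh t * e1 + Real.cosh t * e2 - g t * e3

theorem dotProduct_three (x y : Fin 3 → ℝ) : x ⬝ᵥ y = x 0 * y 0 + x 1 * y 1 + x 2 * y 2 := by
  simp [dotProduct, Fin.sum_univ_three]

namespace IsKilling

variable {ξ : CW5 → CW5}

theorem differentiable (hξ : IsKilling ξ) : Differentiable ℝ ξ := hξ.1.differentiable (by simp)

theorem eq_zero (hξ : IsKilling ξ) (p u v : CW5) :
    2 * (p.2.2 ⬝ᵥ (ξ p).2.2) * (u.2.1 * v.2.1)
      + metric p (fderiv ℝ ξ p u) v + metric p u (fderiv ℝ ξ p v) = 0 := by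
  rw [← lieDerivMetric_eq]
  exact hξ.2 p u v

/-- The null hyperplanes `x⁻ = const` are totally geodesic and flat; the Clairaut integrals along
their lines coincide at any two points. -/
theorem slice (hξ : IsKilling ξ) (t p p' : ℝ) (x x' : Fin 3 → ℝ) :
    (p' - p) * ((ξ (p', t, x')).2.1 - (ξ (p, t, x)).2.1)
      + (x' - x) ⬝ᵥ ((ξ (p', t, x')).2.2 - (ξ (p, t, x)).2.2) = 0 := by
  set q : CW5 := (p, t, x) with hq
  set u : CW5 := (p' - p, 0, x' - x) with hu
  have hd := fun s => hasDerivAt_line hξ.differentiable q u s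
  have h1 : ∀ s, HasDerivAt (fun s : ℝ => (p' - p) * (ξ (q + s • u)).2.1
      + (((x' 0 - x 0) * (ξ (q + s • u)).2.2 0 + (x' 1 - x 1) * (ξ (q + s • u)).2.2 1)
      + (x' 2 - x 2) * (ξ (q + s • u)).2.2 2)) 0 s := fun s => by
    refine (((hasDerivAt_minus (hd s)).const_mul _).fun_add
      ((((hasDerivAt_space (hd s) 0).const_mul _).fun_add
      ((hasDerivAt_space (hd s) 1).const_mul _)).fun_add
      ((hasDerivAt_space (hd s) 2).const_mul _))).congr_deriv ?_
    have := hξ.eq_zero (q + s • u) u u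
    simp only [metric_eq, dotProduct_three] at this
    generalize fderiv ℝ ξ (q + s • u) u = D at this ⊢
    simp [hu] at this
    linear_combination this / 2
  have h2 := eq_of_hasDerivAt_zero h1 1 0
  have h3 : q + (1 : ℝ) • u = (p', t, x') := by simp [hq, hu]
  rw [h3, zero_smul, add_zero] at h2
  simp only [dotProduct_three, Pi.sub_apply]
  linear_combination h2

/-- Polarisation of `slice`, based at the origin of the slice. Letting one of the two points run
through basis vectors reads off each component as an affine function of the other point. -/
theorem slice_polar (hξ : IsKilling ξ) (t p p' : ℝ) (x x' : Fin 3 → ℝ) :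
    p' * ((ξ (p, t, x)).2.1 - (ξ (0, t, 0)).2.1) + x' ⬝ᵥ ((ξ (p, t, x)).2.2 - (ξ (0, t, 0)).2.2)
      + (p * ((ξ (p', t, x')).2.1 - (ξ (0, t, 0)).2.1)
      + x ⬝ᵥ ((ξ (p', t, x')).2.2 - (ξ (0, t, 0)).2.2)) = 0 := by
  have h1 := hξ.slice t p p' x x'
  have h2 := hξ.slice t 0 p 0 x
  have h3 := hξ.slice t 0 p' 0 x'
  simp only [dotProduct_three, Pi.sub_apply, Pi.zero_apply] at *
  linear_combination h2 + h3 - h1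

end IsKilling

/-- The coefficient of `xⁱ` in the component `ξ⁻`. -/
def slope (ξ : CW5 → CW5) (i : Fin 3) (t : ℝ) : ℝ :=
  (ξ (0, t, Pi.single i 1)).2.1 - (ξ (0, t, 0)).2.1

/-- The coefficient of `xⁱ` in the component `ξʲ`. -/
def skew (ξ : CW5 → CW5) (i j : Fin 3) (t : ℝ) : ℝ :=
  (ξ (0, t, Pi.single i 1)).2.2 j - (ξ (0, t, 0)).2.2 j

namespace IsKilling

variable {ξ : CW5 → CW5}

theorem minus_eq (hξ : IsKilling ξ) (p t : ℝ) (x : Fin 3 → ℝ) :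
    (ξ (p, t, x)).2.1 = (ξ (0, t, 0)).2.1
      + (slope ξ 0 t * x 0 + slope ξ 1 t * x 1 + slope ξ 2 t * x 2) := by
  have h1 := hξ.slice_polar t p 1 x 0
  have h2 := fun i => hξ.slice_polar t 0 1 (Pi.single i 1) 0
  -- Both points equal: this gives ξ⁻(1, t, 0) = ξ⁻(0, t, 0), which removes the dependence on p.
  have h3 := hξ.slice_polar t 1 1 0 0
  have e0 := h2 0
  have e1 := h2 1
  have e2 := h2 2
  simp [dotProduct_three] at h1 h3 e0 e1 e2
  simp only [slope]
  linear_combination h1 - p * h3 - x 0 * e0 - x 1 * e1 - x 2 * e2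

theorem skew_antisymm (hξ : IsKilling ξ) (t : ℝ) (i j : Fin 3) :
    skew ξ i j t = -skew ξ j i t := by
  have h := hξ.slice_polar t 0 0 (Pi.single i 1) (Pi.single j 1)
  simp at h
  simp only [skew]
  linear_combination h

theorem space_eq (hξ : IsKilling ξ) (p t : ℝ) (x : Fin 3 → ℝ) (i : Fin 3) :
    (ξ (p, t, x)).2.2 i = (ξ (0, t, 0)).2.2 i - p * slope ξ i t
      + (skew ξ 0 i t * x 0 + skew ξ 1 i t * x 1 + skew ξ 2 i t * x 2) := by
  have h1 := hξ.slice_polar t p 0 x (Pi.single i 1)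
  rw [hξ.skew_antisymm t 0 i, hξ.skew_antisymm t 1 i, hξ.skew_antisymm t 2 i]
  simp [dotProduct_three x] at h1
  simp only [skew, slope]
  linear_combination h1

end IsKilling

/-! ### The Killing equations involving the direction ∂₋ -/

namespace IsKilling

variable {ξ : CW5 → CW5}

theorem hasDerivAt_dPlus (hξ : IsKilling ξ) (p t : ℝ) (x : Fin 3 → ℝ) :
    HasDerivAt (fun s => ξ (s, t, x)) (fderiv ℝ ξ (p, t, x) dPlus) p := by
  have h := hasDerivAt_line hξ.differentiable (0, t, x) dPlus p
  simpa [dPlus] using h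

theorem hasDerivAt_dMinus (hξ : IsKilling ξ) (p t : ℝ) (x : Fin 3 → ℝ) :
    HasDerivAt (fun s => ξ (p, s, x)) (fderiv ℝ ξ (p, t, x) dMinus) t := by
  have h := hasDerivAt_line hξ.differentiable (p, 0, x) dMinus t
  simpa [dMinus] using h

theorem hasDerivAt_space_line (hξ : IsKilling ξ) (p t : ℝ) (x v : Fin 3 → ℝ) (s : ℝ) :
    HasDerivAt (fun s => ξ (p, t, x + s • v)) (fderiv ℝ ξ (p, t, x + s • v) (0, 0, v)) s := by
  have h := hasDerivAt_line hξ.differentiable (p, t, x) (0, 0, v) s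
  simpa using h

theorem killing_plus_minus (hξ : IsKilling ξ) (q : CW5) :
    (fderiv ℝ ξ q dPlus).1 = -(fderiv ℝ ξ q dMinus).2.1 := by
  have h1 := hξ.eq_zero q dPlus dPlus
  have h2 := hξ.eq_zero q dPlus dMinus
  simp only [metric_eq] at h1 h2
  simp [dPlus, dMinus] at h1 h2
  simp only [dPlus, dMinus]
  linear_combination h2 - (q.2.2 ⬝ᵥ q.2.2) * h1

theorem killing_minus_minus (hξ : IsKilling ξ) (q : CW5) :
    (fderiv ℝ ξ q dMinus).1 =
      -(q.2.2 ⬝ᵥ (ξ q).2.2) - (q.2.2 ⬝ᵥ q.2.2) * (fderiv ℝ ξ q dMinus).2.1 := by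
  have h1 := hξ.eq_zero q dMinus dMinus
  simp only [metric_eq] at h1
  simp [dMinus] at h1
  simp only [dMinus]
  linear_combination h1 / 2

theorem killing_minus_space (hξ : IsKilling ξ) (q : CW5) (v : Fin 3 → ℝ) :
    (fderiv ℝ ξ q (0, 0, v)).1 =
      -((fderiv ℝ ξ q dMinus).2.2 ⬝ᵥ v) - (q.2.2 ⬝ᵥ q.2.2) * (fderiv ℝ ξ q (0, 0, v)).2.1 := by
  have h1 := hξ.eq_zero q dMinus (0, 0, v)
  simp only [metric_eq] at h1
  simp [dMinus] at h1
  simp only [dMinus]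
  linear_combination h1

theorem dMinus_minus_eq (hξ : IsKilling ξ) (p t : ℝ) (x : Fin 3 → ℝ) :
    (fderiv ℝ ξ (p, t, x) dMinus).2.1 = (fderiv ℝ ξ (0, t, x) dMinus).2.1 := by
  have h1 := hasDerivAt_minus (hξ.hasDerivAt_dMinus p t x)
  have h2 := hasDerivAt_minus (hξ.hasDerivAt_dMinus 0 t x)
  have e : (fun s => (ξ (p, s, x)).2.1) = fun s => (ξ (0, s, x)).2.1 := by
    funext s
    rw [hξ.minus_eq p s x, hξ.minus_eq 0 s x]
  rw [e] at h1
  exact h1.unique h2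

/-- By `killing_plus_minus` the derivative of ξ⁺ in p is -∂₋ξ⁻, which does not depend on p. -/
theorem plus_eq_sub (hξ : IsKilling ξ) (p t : ℝ) (x : Fin 3 → ℝ) :
    (ξ (p, t, x)).1 = (ξ (0, t, x)).1 - p * (fderiv ℝ ξ (0, t, x) dMinus).2.1 := by
  have h : ∀ s, HasDerivAt (fun s => (ξ (s, t, x)).1) (-(fderiv ℝ ξ (0, t, x) dMinus).2.1) s :=
    fun s => (hasDerivAt_fst (hξ.hasDerivAt_dPlus s t x)).congr_deriv (by
      rw [hξ.killing_plus_minus, hξ.dMinus_minus_eq])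
  have := eq_add_mul_of_hasDerivAt_const h p
  linear_combination this

theorem hasDerivAt_slope (hξ : IsKilling ξ) (i : Fin 3) (t : ℝ) :
    HasDerivAt (slope ξ i) ((fderiv ℝ ξ (0, t, Pi.single i 1) dMinus).2.1
      - (fderiv ℝ ξ (0, t, 0) dMinus).2.1) t :=
  (hasDerivAt_minus (hξ.hasDerivAt_dMinus 0 t (Pi.single i 1))).fun_sub
    (hasDerivAt_minus (hξ.hasDerivAt_dMinus 0 t 0))

theorem dMinus_minus_single (hξ : IsKilling ξ) (i : Fin 3) (s t : ℝ) :
    (fderiv ℝ ξ (0, t, s • Pi.single i 1) dMinus).2.1 = (fderiv ℝ ξ (0, t, 0) dMinus).2.1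
      + s * deriv (slope ξ i) t := by
  have h1 := hasDerivAt_minus (hξ.hasDerivAt_dMinus 0 t (s • Pi.single i 1))
  have h2 := (hasDerivAt_minus (hξ.hasDerivAt_dMinus 0 t 0)).fun_add
    ((hξ.hasDerivAt_slope i t).differentiableAt.hasDerivAt.const_mul s)
  refine h1.unique (h2.congr_of_eventuallyEq (Filter.Eventually.of_forall fun r => ?_))
  simp only [hξ.minus_eq 0 r (s • Pi.single i 1)]
  fin_cases i <;> simp [mul_comm]

/-- The change of ∂ᵢξ⁺ at x = 0 between p = 0 and p = 1 is computed twice. The equation for (∂₋, ∂ᵢ)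
gives +`slope`', through the term -p `slope` of ξⁱ; the formula `plus_eq_sub` gives -`slope`'. So
`slope`' = 0. -/
theorem deriv_slope (hξ : IsKilling ξ) (i : Fin 3) (t : ℝ) : deriv (slope ξ i) t = 0 := by
  have hs := (hξ.hasDerivAt_slope i t).differentiableAt.hasDerivAt
  have h1 := (hasDerivAt_space (hξ.hasDerivAt_dMinus 1 t 0) i).unique
    (((hasDerivAt_space (hξ.hasDerivAt_dMinus 0 t 0) i).fun_sub hs).congr_of_eventuallyEq
      (Filter.Eventually.of_forall fun r => by simp [hξ.space_eq 1 r 0 i]))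
  have k := fun p => hξ.killing_minus_space (p, t, 0) (Pi.single i 1)
  have k0 := k 0
  have k1 := k 1
  have l := fun p => hasDerivAt_fst (hξ.hasDerivAt_space_line p t 0 (Pi.single i 1) 0)
  have l0 := l 0
  have l1 := l 1
  simp only [zero_smul, add_zero, zero_add] at l0 l1
  have h2 := l1.unique ((l0.fun_sub (((hasDerivAt_id (0 : ℝ)).mul_const
    (deriv (slope ξ i) t)).const_add
      (fderiv ℝ ξ (0, t, 0) dMinus).2.1)).congr_of_eventuallyEq
      (Filter.Eventually.of_forall fun r => by
        simp only [hξ.plus_eq_sub 1, hξ.dMinus_minus_single, id]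
        ring))
  simp at k0 k1
  linear_combination (h2 + h1 + k0 - k1) / 2

/-- The mixed second difference of ξ⁺ in p and along the i-th axis vanishes because `slope`' = 0.
Its derivative in x⁻ is, by `killing_minus_minus`, the `slope` itself. -/
theorem slope_eq_zero (hξ : IsKilling ξ) (i : Fin 3) (t : ℝ) : slope ξ i t = 0 := by
  have d := fun p x => hasDerivAt_fst (hξ.hasDerivAt_dMinus p t x)
  have dm : ∀ r, (fderiv ℝ ξ (0, r, Pi.single i 1) dMinus).2.1
      = (fderiv ℝ ξ (0, r, 0) dMinus).2.1 := fun r => by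
    simpa [hξ.deriv_slope] using hξ.dMinus_minus_single i 1 r
  have h := ((((d 1 (Pi.single i 1)).fun_sub (d 0 (Pi.single i 1))).fun_sub
    (d 1 0)).fun_add (d 0 0)).unique ((hasDerivAt_const t (0 : ℝ)).congr_of_eventuallyEq
      (Filter.Eventually.of_forall fun r => by
        simp only [hξ.plus_eq_sub 1, dm]
        ring))
  have k := fun p x => hξ.killing_minus_minus (p, t, x)
  rw [k 1 (Pi.single i 1), k 0 (Pi.single i 1), k 1 0, k 0 0] at h
  simp [hξ.space_eq 1 t (Pi.single i 1), hξ.space_eq 0 t (Pi.single i 1), hξ.dMinus_minus_eq 1] at h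
  linear_combination h

theorem minus_eq_zero_zero (hξ : IsKilling ξ) (p t : ℝ) (x : Fin 3 → ℝ) :
    (ξ (p, t, x)).2.1 = (ξ (0, t, 0)).2.1 := by
  simp [hξ.minus_eq p t x, hξ.slope_eq_zero]

theorem dMinus_minus_eq_zero_zero (hξ : IsKilling ξ) (p t : ℝ) (x : Fin 3 → ℝ) :
    (fderiv ℝ ξ (p, t, x) dMinus).2.1 = (fderiv ℝ ξ (0, t, 0) dMinus).2.1 :=
  (hasDerivAt_minus (hξ.hasDerivAt_dMinus p t x)).unique
    ((hasDerivAt_minus (hξ.hasDerivAt_dMinus 0 t 0)).congr_of_eventuallyEq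
      (Filter.Eventually.of_forall fun r => hξ.minus_eq_zero_zero p r x))

theorem fderiv_space_minus (hξ : IsKilling ξ) (p t : ℝ) (x v : Fin 3 → ℝ) :
    (fderiv ℝ ξ (p, t, x) (0, 0, v)).2.1 = 0 := by
  have h := hasDerivAt_minus (hξ.hasDerivAt_space_line p t x v 0)
  simp only [zero_smul, add_zero] at h
  exact h.unique ((hasDerivAt_const (0 : ℝ) ((ξ (0, t, 0)).2.1)).congr_of_eventuallyEq
      (Filter.Eventually.of_forall fun r => hξ.minus_eq_zero_zero p t _))

theorem space_eq' (hξ : IsKilling ξ) (p t : ℝ) (x : Fin 3 → ℝ) (i : Fin 3) :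
    (ξ (p, t, x)).2.2 i = (ξ (0, t, 0)).2.2 i
      + (skew ξ 0 i t * x 0 + skew ξ 1 i t * x 1 + skew ξ 2 i t * x 2) := by
  simp [hξ.space_eq p t x, hξ.slope_eq_zero]

theorem hasDerivAt_skew (hξ : IsKilling ξ) (i j : Fin 3) (t : ℝ) :
    HasDerivAt (skew ξ i j) (deriv (skew ξ i j) t) t :=
  ((hasDerivAt_space (hξ.hasDerivAt_dMinus 0 t (Pi.single i 1)) j).fun_sub
    (hasDerivAt_space (hξ.hasDerivAt_dMinus 0 t 0) j)).differentiableAt.hasDerivAt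

theorem deriv_skew_antisymm (hξ : IsKilling ξ) (i j : Fin 3) (t : ℝ) :
    deriv (skew ξ i j) t = -deriv (skew ξ j i) t :=
  (hξ.hasDerivAt_skew i j t).unique ((hξ.hasDerivAt_skew j i t).neg.congr_of_eventuallyEq
    (Filter.Eventually.of_forall fun r => hξ.skew_antisymm r i j))

theorem dMinus_space_eq (hξ : IsKilling ξ) (p t : ℝ) (x : Fin 3 → ℝ) (i : Fin 3) :
    (fderiv ℝ ξ (p, t, x) dMinus).2.2 i = (fderiv ℝ ξ (0, t, 0) dMinus).2.2 i
      + (deriv (skew ξ 0 i) t * x 0 + deriv (skew ξ 1 i) t * x 1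
      + deriv (skew ξ 2 i) t * x 2) :=
  (hasDerivAt_space (hξ.hasDerivAt_dMinus p t x) i).unique
    (((hasDerivAt_space (hξ.hasDerivAt_dMinus 0 t 0) i).fun_add
      ((((hξ.hasDerivAt_skew 0 i t).mul_const (x 0)).fun_add
      ((hξ.hasDerivAt_skew 1 i t).mul_const (x 1))).fun_add
      ((hξ.hasDerivAt_skew 2 i t).mul_const (x 2)))).congr_of_eventuallyEq
      (Filter.Eventually.of_forall fun r => hξ.space_eq' p r x i))

/-- Along the ray s ↦ s x, the equation for (∂₋, x) gives ξ⁺ a constant derivative: the terms with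
`skew`' are quadratic in x and cancel by antisymmetry. -/
theorem plus_eq_sub_dotProduct (hξ : IsKilling ξ) (t : ℝ) (x : Fin 3 → ℝ) :
    (ξ (0, t, x)).1 = (ξ (0, t, 0)).1 - (fderiv ℝ ξ (0, t, 0) dMinus).2.2 ⬝ᵥ x := by
  have h : ∀ s, HasDerivAt (fun s : ℝ => (ξ (0, t, 0 + s • x)).1)
      (-((fderiv ℝ ξ (0, t, 0) dMinus).2.2 ⬝ᵥ x)) s := fun s =>
    (hasDerivAt_fst (hξ.hasDerivAt_space_line 0 t 0 x s)).congr_deriv (by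
      rw [hξ.killing_minus_space, hξ.fderiv_space_minus]
      have a := fun i j => hξ.deriv_skew_antisymm i j t
      simp [dotProduct_three, hξ.dMinus_space_eq 0 t (s • x)]
      linear_combination -s * x 0 * x 0 * a 0 0 / 2 - s * x 1 * x 1 * a 1 1 / 2
        - s * x 2 * x 2 * a 2 2 / 2 - s * x 0 * x 1 * a 0 1 - s * x 0 * x 2 * a 0 2
        - s * x 1 * x 2 * a 1 2)
  have := eq_add_mul_of_hasDerivAt_const h 1
  simp at this
  linear_combination this

/-- At the i-th basis vector, ∂ⱼξ⁺ is -ωⱼ' by affinity of ξ⁺, but -(ωⱼ' + `skew`') by the Killing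
equation, where ω is the spatial part of ξ at x = 0. -/
theorem deriv_skew (hξ : IsKilling ξ) (i j : Fin 3) (t : ℝ) : deriv (skew ξ i j) t = 0 := by
  have h := hasDerivAt_fst (hξ.hasDerivAt_space_line 0 t (Pi.single i 1) (Pi.single j 1) 0)
  have h2 := h.unique ((((hasDerivAt_id (0 : ℝ)).mul_const
    ((fderiv ℝ ξ (0, t, 0) dMinus).2.2 j)).const_sub
      ((ξ (0, t, 0)).1 - (fderiv ℝ ξ (0, t, 0) dMinus).2.2 i)).congr_of_eventuallyEq
      (Filter.Eventually.of_forall fun r => by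
        simp [hξ.plus_eq_sub_dotProduct t (Pi.single i 1 + r • Pi.single j 1)]
        ring))
  rw [zero_smul, add_zero, hξ.killing_minus_space, hξ.fderiv_space_minus] at h2
  simp [hξ.dMinus_space_eq 0 t (Pi.single i 1) j] at h2
  fin_cases i <;> simpa using h2

/-- The second difference of the affine function ξ⁺ at ±x¹ is zero, while its derivative in x⁻
contains the quadratic term -|x|² ∂₋ξ⁻. -/
theorem dMinus_minus_zero (hξ : IsKilling ξ) (t : ℝ) :
    (fderiv ℝ ξ (0, t, 0) dMinus).2.1 = 0 := by
  have d := fun x => hasDerivAt_fst (hξ.hasDerivAt_dMinus 0 t x)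
  have h := (((d (Pi.single 0 1)).fun_add (d (-Pi.single 0 1))).fun_sub
    ((d 0).const_mul 2)).unique ((hasDerivAt_const t (0 : ℝ)).congr_of_eventuallyEq
      (Filter.Eventually.of_forall fun r => by
        simp [hξ.plus_eq_sub_dotProduct r (Pi.single 0 1),
          hξ.plus_eq_sub_dotProduct r (-Pi.single 0 1)]
        ring))
  have a := hξ.skew_antisymm t 0 0
  simp [hξ.killing_minus_minus, hξ.space_eq' 0 t (Pi.single 0 1),
    hξ.space_eq' 0 t (-Pi.single 0 1), hξ.dMinus_minus_eq_zero_zero 0 t (Pi.single 0 1),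
    hξ.dMinus_minus_eq_zero_zero 0 t (-Pi.single 0 1)] at h
  linear_combination -h / 2 - a / 2

theorem dMinus_plus_zero (hξ : IsKilling ξ) (t : ℝ) : (fderiv ℝ ξ (0, t, 0) dMinus).1 = 0 := by
  simp [hξ.killing_minus_minus]

/-- The equation ω'' = ω: here ωᵢ' is the difference of ξ⁺ at x = 0 and at the i-th basis vector,
and `killing_minus_minus` differentiates it once more. -/
theorem hasDerivAt_dMinus_space (hξ : IsKilling ξ) (t : ℝ) (i : Fin 3) :
    HasDerivAt (fun s => (fderiv ℝ ξ (0, s, 0) dMinus).2.2 i) ((ξ (0, t, 0)).2.2 i) t := by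
  have d := fun x => hasDerivAt_fst (hξ.hasDerivAt_dMinus 0 t x)
  refine (((d 0).fun_sub (d (Pi.single i 1))).congr_of_eventuallyEq
      (Filter.Eventually.of_forall fun r => by
        simp [hξ.plus_eq_sub_dotProduct r (Pi.single i 1)])).congr_deriv ?_
  have a := hξ.skew_antisymm t i i
  simp [hξ.killing_minus_minus, hξ.dMinus_minus_eq_zero_zero 0 t (Pi.single i 1),
    hξ.dMinus_minus_zero]
  simp only [skew] at a
  linear_combination a / 2

/-- Every Killing field is one of the fields `ξ_X`. -/
theorem exists_eq_field (hξ : IsKilling ξ) : ∃ X, ξ = field X := by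
  refine ⟨⟨(ξ (0, 0, 0)).2.1, (ξ (0, 0, 0)).1, (ξ (0, 0, 0)).2.2,
    -(fderiv ℝ ξ (0, 0, 0) dMinus).2.2, ![skew ξ 1 2 0, skew ξ 2 0 0, skew ξ 0 1 0]⟩, ?_⟩
  have hα : ∀ t, (ξ (0, t, 0)).2.1 = (ξ (0, 0, 0)).2.1 := fun t =>
    eq_of_hasDerivAt_zero (f := fun s => (ξ (0, s, 0)).2.1) (fun s =>
      (hasDerivAt_minus (hξ.hasDerivAt_dMinus 0 s 0)).congr_deriv (hξ.dMinus_minus_zero s)) t 0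
  have hγ : ∀ t, (ξ (0, t, 0)).1 = (ξ (0, 0, 0)).1 := fun t =>
    eq_of_hasDerivAt_zero (f := fun s => (ξ (0, s, 0)).1) (fun s =>
      (hasDerivAt_fst (hξ.hasDerivAt_dMinus 0 s 0)).congr_deriv (hξ.dMinus_plus_zero s)) t 0
  have hm : ∀ i j t, skew ξ i j t = skew ξ i j 0 := fun i j t =>
    eq_of_hasDerivAt_zero (fun s => (hξ.hasDerivAt_skew i j s).congr_deriv (hξ.deriv_skew i j s)) t 0
  have hω := fun i => eq_cosh_add_sinh (f := fun s => (ξ (0, s, 0)).2.2 i)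
    (fun t => hasDerivAt_space (hξ.hasDerivAt_dMinus 0 t 0) i)
    (fun t => hξ.hasDerivAt_dMinus_space t i)
  funext ⟨p, t, x⟩
  rw [field_apply]
  refine Prod.ext ?_ (Prod.ext ?_ ?_)
  · rw [hξ.plus_eq_sub, hξ.dMinus_minus_eq_zero_zero, hξ.dMinus_minus_zero,
      hξ.plus_eq_sub_dotProduct, hγ]
    simp only [dotProduct_three, (hω _ t).2, wave_apply, Pi.neg_apply]
    ring
  · rw [hξ.minus_eq_zero_zero, hα]
  · have a := fun i j => hξ.skew_antisymm 0 i j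
    funext i
    rw [hξ.space_eq', (hω i t).1]
    simp only [hm]
    fin_cases i
    · simp [wave_apply, cross_apply]
      linear_combination x 0 * a 0 0 / 2 + x 1 * a 1 0
    · simp [wave_apply, cross_apply]
      linear_combination x 1 * a 1 1 / 2 + x 2 * a 2 1
    · simp [wave_apply, cross_apply]
      linear_combination x 2 * a 2 2 / 2 + x 0 * a 0 2

end IsKilling

/-! ### Isometries and their action on the fields `ξ_X` -/

/-- Two vector fields are related if an isometry takes one to the other. -/
def Related (ξ η : CW5 → CW5) : Prop :=
  ∃ φ : CW5 ≃ CW5, IsIsometry φ ∧ ∀ p, fderiv ℝ φ p (ξ p) = η (φ p)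

namespace Related

variable {ξ η ζ : CW5 → CW5}

theorem trans (h₁ : Related ξ η) (h₂ : Related η ζ) : Related ξ ζ := by
  obtain ⟨φ, ⟨hφ, hφ', hφm⟩, h₁⟩ := h₁
  obtain ⟨ψ, ⟨hψ, hψ', hψm⟩, h₂⟩ := h₂
  have hd : ∀ p u, fderiv ℝ (φ.trans ψ) p u = fderiv ℝ ψ (φ p) (fderiv ℝ φ p u) := fun p u => by
    rw [Equiv.coe_trans, fderiv_comp p (hψ.differentiable (by simp) _)
      (hφ.differentiable (by simp) _)]
    rfl
  refine ⟨φ.trans ψ, ⟨hψ.comp hφ, hφ'.comp hψ', fun p u v => ?_⟩, fun p => ?_⟩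
  · rw [hd, hd, Equiv.trans_apply, hψm, hφm]
  · rw [hd, h₁, h₂, Equiv.trans_apply]

theorem smul (h : Related ξ η) (r : ℝ) : Related (r • ξ) (r • η) := by
  obtain ⟨φ, hφ, h⟩ := h
  exact ⟨φ, hφ, fun p => by simp [h]⟩

theorem refl (ξ : CW5 → CW5) : Related ξ ξ := by
  refine ⟨Equiv.refl _, ⟨contDiff_id, contDiff_id, fun p u v => ?_⟩, fun p => ?_⟩
  · simp [Equiv.coe_refl]
  · simp [Equiv.coe_refl]

theorem norm_ne_zero (h : Related ξ η) (hξ : ∀ p, metric p (ξ p) (ξ p) ≠ 0) (p : CW5) :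
    metric p (η p) (η p) ≠ 0 := by
  obtain ⟨φ, ⟨_, _, hm⟩, h⟩ := h
  have := hm (φ.symm p) (ξ (φ.symm p)) (ξ (φ.symm p))
  rw [h, Equiv.apply_symm_apply] at this
  rw [this]
  exact hξ _

theorem exists_pushforward (h : Related ξ η) :
    ∃ φ : CW5 ≃ CW5, IsIsometry φ ∧ pushforward φ ξ = η := by
  obtain ⟨φ, hφ, h⟩ := h
  exact ⟨φ, hφ, funext fun q => by rw [pushforward, h, Equiv.apply_symm_apply]⟩

end Related

/-- The translation `x⁻ ↦ x⁻ + s`. -/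
def boost (s : ℝ) : CW5 ≃ CW5 := Equiv.addRight (0, s, 0)

theorem related_boost (X : Alg) (s : ℝ) :
    Related (field X) (field ⟨X.minus, X.plus, Real.cosh s • X.cE + Real.sinh s • X.cEs,
      Real.sinh s • X.cE + Real.cosh s • X.cEs, X.cV⟩) := by
  have hd : ∀ p u, fderiv ℝ (boost s) p u = u := fun p u => by
    have : (boost s : CW5 → CW5) = fun p => p + (0, s, 0) := rfl
    rw [this, fderiv_add_const]
    simp
  refine ⟨boost s, ⟨?_, ?_, fun p u v => ?_⟩, ?_⟩
  · exact contDiff_id.add contDiff_const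
  · exact contDiff_id.add contDiff_const
  · rw [hd, hd]
    simp [metric, boost]
  · rintro ⟨p, t, x⟩
    rw [hd]
    have e : boost s (p, t, x) = (p, t + s, x) := by simp [boost]
    have h3 := Real.cosh_sq s
    rw [e, field_apply, field_apply]
    refine Prod.ext ?_ (Prod.ext rfl ?_)
    · simp [dotProduct_three, wave_apply, Real.cosh_add, Real.sinh_add]
      linear_combination -(Real.cosh t * (X.cEs 0 * x 0 + X.cEs 1 * x 1 + X.cEs 2 * x 2)
        - Real.sinh t * (X.cE 0 * x 0 + X.cE 1 * x 1 + X.cE 2 * x 2)) * h3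
    · funext i
      simp [wave_apply, Real.cosh_add, Real.sinh_add]
      linear_combination -(Real.cosh t * X.cE i - Real.sinh t * X.cEs i) * h3

/-- The action of the Heisenberg group generated by the `eᵢ` and `eᵢ^*`. -/
noncomputable def heisenberg (u v : Fin 3 → ℝ) : CW5 ≃ CW5 where
  toFun p := (p.1 + wave v u p.2.1 ⬝ᵥ p.2.2 + wave v u p.2.1 ⬝ᵥ wave u v p.2.1 / 2, p.2.1,
    p.2.2 + wave u v p.2.1)
  invFun p := (p.1 - wave v u p.2.1 ⬝ᵥ (p.2.2 - wave u v p.2.1)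
    - wave v u p.2.1 ⬝ᵥ wave u v p.2.1 / 2, p.2.1, p.2.2 - wave u v p.2.1)
  left_inv p := Prod.ext (by simp; ring) (by simp)
  right_inv p := Prod.ext (by simp; ring) (by simp)

theorem contDiff_wave (c d : Fin 3 → ℝ) : ContDiff ℝ ∞ (wave c d) := by
  unfold wave
  have := Real.contDiff_cosh (n := ∞)
  have := Real.contDiff_sinh (n := ∞)
  fun_prop

theorem contDiff_dotProduct {f g : CW5 → Fin 3 → ℝ} (hf : ContDiff ℝ ∞ f) (hg : ContDiff ℝ ∞ g) :
    ContDiff ℝ ∞ (fun p => f p ⬝ᵥ g p) := by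
  simp only [dotProduct]
  fun_prop

theorem fderiv_heisenberg (u v : Fin 3 → ℝ) (p w : CW5) (h : ContDiff ℝ ∞ (heisenberg u v)) :
    fderiv ℝ (heisenberg u v) p w =
      (w.1 + wave v u p.2.1 ⬝ᵥ w.2.2 - w.2.1 * (wave u v p.2.1 ⬝ᵥ p.2.2)
        - w.2.1 * (wave u v p.2.1 ⬝ᵥ wave u v p.2.1 + wave v u p.2.1 ⬝ᵥ wave v u p.2.1) / 2,
        w.2.1, w.2.2 - w.2.1 • wave v u p.2.1) := by
  refine fderiv_apply_eq_of_line (h.differentiable (by simp)) ?_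
  obtain ⟨p, t, x⟩ := p
  obtain ⟨w₁, w₂, w₃⟩ := w
  have e : (fun s : ℝ => heisenberg u v ((p, t, x) + s • ((w₁, w₂, w₃) : CW5))) = fun s =>
      (p + s * w₁ + ∑ i, wave v u (t + s * w₂) i * (x i + s * w₃ i)
        + (∑ i, wave v u (t + s * w₂) i * wave u v (t + s * w₂) i) * (1 / 2), t + s * w₂,
        fun i => x i + s * w₃ i + wave u v (t + s * w₂) i) := by
    funext s
    refine Prod.ext ?_ (Prod.ext ?_ ?_)
    · simp [heisenberg, dotProduct]
      ring
    · simp [heisenberg]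
    · funext i
      simp [heisenberg]
  rw [e]
  have hl : ∀ a b : ℝ, HasDerivAt (fun s : ℝ => a + s * b) b 0 := fun a b => by
    simpa using ((hasDerivAt_id (0 : ℝ)).mul_const b).const_add a
  have hw : ∀ (c d : Fin 3 → ℝ) i, HasDerivAt (fun s : ℝ => wave c d (t + s * w₂) i)
      (-wave d c t i * w₂) 0 := fun c d i => by
    have h := hasDerivAt_wave c d (t + 0 * w₂) i
    have h' := h.comp (0 : ℝ) (hl t w₂)
    rw [zero_mul, add_zero] at h'
    exact h'
  refine HasDerivAt.prodMk ?_ (HasDerivAt.prodMk (hl t w₂) (hasDerivAt_pi.2 fun i => ?_))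
  · refine (((hl p w₁).fun_add (HasDerivAt.fun_sum (u := Finset.univ) fun i _ =>
      (hw v u i).fun_mul (hl (x i) (w₃ i)))).fun_add
      ((HasDerivAt.fun_sum (u := Finset.univ) fun i _ =>
      (hw v u i).fun_mul (hw u v i)).mul_const (1 / 2))).congr_deriv ?_
    simp [dotProduct_three, Fin.sum_univ_three]
    ring
  · refine ((hl (x i) (w₃ i)).fun_add (hw u v i)).congr_deriv ?_
    simp
    ring

/-- `heisenberg u v` is the time-one flow of ξ_Y for Y = ∑ uᵢ eᵢ + vᵢ eᵢ^*, which explains the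
quadratic term with factor 1/2. The new coefficients depend on x⁻ only through cosh² - sinh² = 1. -/
theorem related_heisenberg (X : Alg) (u v : Fin 3 → ℝ) :
    Related (field X) (field ⟨X.minus, X.plus + v ⬝ᵥ X.cE - u ⬝ᵥ X.cEs + (X.cV ⨯₃ v) ⬝ᵥ u
      + X.minus * (u ⬝ᵥ u - v ⬝ᵥ v) / 2, X.cE - X.cV ⨯₃ u - X.minus • v,
      X.cEs - X.cV ⨯₃ v - X.minus • u, X.cV⟩) := by
  have h1 := fun c d : Fin 3 → ℝ => (contDiff_wave c d).comp
    (f := fun p : CW5 => p.2.1) (by fun_prop)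
  have h2 : ContDiff ℝ ∞ (fun p : CW5 => p.2.2) := by fun_prop
  have hc : ContDiff ℝ ∞ (heisenberg u v) :=
    ((contDiff_fst.add (contDiff_dotProduct (h1 v u) h2)).add
      ((contDiff_dotProduct (h1 v u) (h1 u v)).div_const 2)).prodMk
      ((by fun_prop : ContDiff ℝ ∞ (fun p : CW5 => p.2.1)).prodMk (h2.add (h1 u v)))
  have hc' : ContDiff ℝ ∞ (heisenberg u v).symm :=
    ((contDiff_fst.sub (contDiff_dotProduct (h1 v u) (h2.sub (h1 u v)))).sub
      ((contDiff_dotProduct (h1 v u) (h1 u v)).div_const 2)).prodMk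
      ((by fun_prop : ContDiff ℝ ∞ (fun p : CW5 => p.2.1)).prodMk (h2.sub (h1 u v)))
  refine ⟨heisenberg u v, ⟨hc, hc', fun p w z => ?_⟩, ?_⟩
  · rw [fderiv_heisenberg u v p w hc, fderiv_heisenberg u v p z hc, metric_eq, metric_eq]
    simp [heisenberg, dotProduct_three]
    ring
  · rintro ⟨p, t, x⟩
    have h3 := Real.cosh_sq t
    rw [fderiv_heisenberg _ _ _ _ hc]
    have e : heisenberg u v (p, t, x) = (p + wave v u t ⬝ᵥ x + wave v u t ⬝ᵥ wave u v t / 2, t,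
      x + wave u v t) := rfl
    rw [e, field_apply, field_apply]
    refine Prod.ext ?_ (Prod.ext rfl ?_)
    · simp [dotProduct_three, wave_apply, cross_apply, Matrix.vecHead, Matrix.vecTail]
      linear_combination (v 0 * X.cE 0 + v 1 * X.cE 1 + v 2 * X.cE 2
        - (u 0 * X.cEs 0 + u 1 * X.cEs 1 + u 2 * X.cEs 2)
        + ((X.cV 1 * v 2 - X.cV 2 * v 1) * u 0 + (X.cV 2 * v 0 - X.cV 0 * v 2) * u 1
          + (X.cV 0 * v 1 - X.cV 1 * v 0) * u 2)
        + X.minus * (u 0 * u 0 + u 1 * u 1 + u 2 * u 2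
          - (v 0 * v 0 + v 1 * v 1 + v 2 * v 2)) / 2) * h3
    · funext i
      fin_cases i <;>
      · simp [wave_apply, cross_apply, Matrix.vecHead, Matrix.vecTail]
        ring

/-- The action of a rotation of `ℝ³`. -/
def rotation (Q : (Fin 3 → ℝ) ≃ₗ[ℝ] (Fin 3 → ℝ)) : CW5 ≃ CW5 :=
  (Equiv.refl ℝ).prodCongr ((Equiv.refl ℝ).prodCongr Q.toEquiv)

theorem related_rotation (X : Alg) (Q : (Fin 3 → ℝ) ≃ₗ[ℝ] (Fin 3 → ℝ))
    (hdot : ∀ x y, Q x ⬝ᵥ Q y = x ⬝ᵥ y) (hcross : ∀ x y, Q (x ⨯₃ y) = Q x ⨯₃ Q y) :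
    Related (field X) (field ⟨X.minus, X.plus, Q X.cE, Q X.cEs, Q X.cV⟩) := by
  have hlin : (rotation Q : CW5 → CW5) =
      (LinearMap.id.prodMap (LinearMap.id.prodMap Q.toLinearMap)).toContinuousLinearMap := rfl
  have hlin' : ((rotation Q).symm : CW5 → CW5) =
      (LinearMap.id.prodMap (LinearMap.id.prodMap Q.symm.toLinearMap)).toContinuousLinearMap := rfl
  have hd : ∀ p u, fderiv ℝ (rotation Q) p u = (u.1, u.2.1, Q u.2.2) := fun p u => by
    rw [hlin, ContinuousLinearMap.fderiv]
    rfl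
  have hwave : ∀ c d t, Q (wave c d t) = wave (Q c) (Q d) t := fun c d t => by
    simp [wave, map_sub, map_smul]
  refine ⟨rotation Q, ⟨?_, ?_, fun p u v => ?_⟩, ?_⟩
  · rw [hlin]
    exact ContinuousLinearMap.contDiff _
  · rw [hlin']
    exact ContinuousLinearMap.contDiff _
  · rw [hd, hd, metric_eq, metric_eq]
    simp [rotation, hdot]
  · rintro ⟨p, t, x⟩
    have e : rotation Q (p, t, x) = (p, t, Q x) := rfl
    rw [hd, e, field_apply, field_apply]
    simp [← hwave, hdot, hcross]

/-- Right-handed orthonormal frames. -/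
theorem exists_rotation_of_frame (f : Fin 3 → Fin 3 → ℝ)
    (hf : ∀ i j, f i ⬝ᵥ f j = if i = j then 1 else 0)
    (h01 : f 0 ⨯₃ f 1 = f 2) (h12 : f 1 ⨯₃ f 2 = f 0) (h20 : f 2 ⨯₃ f 0 = f 1) :
    ∃ Q : (Fin 3 → ℝ) ≃ₗ[ℝ] (Fin 3 → ℝ), (∀ x i, Q x i = f i ⬝ᵥ x) ∧
      (∀ x y, Q x ⬝ᵥ Q y = x ⬝ᵥ y) ∧ ∀ x y, Q (x ⨯₃ y) = Q x ⨯₃ Q y := by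
  set M : Matrix (Fin 3) (Fin 3) ℝ := Matrix.of f with hM
  have h1 : M * Mᵀ = 1 := by
    ext i j
    simpa [Matrix.mul_apply, hM, Matrix.one_apply, dotProduct] using hf i j
  have h2 : Mᵀ * M = 1 := mul_eq_one_comm.1 h1
  refine ⟨Matrix.toLin'OfInv h2 h1, fun x i => rfl, fun x y => ?_, fun x y => ?_⟩
  · change M *ᵥ x ⬝ᵥ M *ᵥ y = x ⬝ᵥ y
    rw [Matrix.dotProduct_mulVec, ← Matrix.mulVec_transpose, Matrix.mulVec_mulVec, h2,
      Matrix.one_mulVec]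
  · change M *ᵥ (x ⨯₃ y) = (M *ᵥ x) ⨯₃ (M *ᵥ y)
    have hc : ∀ i, (M *ᵥ (x ⨯₃ y)) i = f i ⬝ᵥ (x ⨯₃ y) := fun i => rfl
    have hx : ∀ i, (M *ᵥ x) i = f i ⬝ᵥ x := fun i => rfl
    have hy : ∀ i, (M *ᵥ y) i = f i ⬝ᵥ y := fun i => rfl
    -- The components of `Mx × My` are 2 × 2 minors. By the Binet–Cauchy identity each equals (fⱼ ×
    -- fₖ)·(x × y) with fⱼ × fₖ = fᵢ.
    funext i
    fin_cases i
    · simp [hc, cross_apply (M *ᵥ x), hx, hy]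
      rw [← h12, cross_dot_cross]
      ring
    · simp [hc, cross_apply (M *ᵥ x), hx, hy]
      rw [← h20, cross_dot_cross]
      ring
    · simp [hc, cross_apply (M *ᵥ x), hx, hy]
      rw [← h01, cross_dot_cross]
      ring

theorem dotProduct_self_pos {v : Fin 3 → ℝ} (hv : v ≠ 0) : 0 < v ⬝ᵥ v := by
  refine lt_of_le_of_ne ?_ fun h => hv (dotProduct_self_eq_zero.1 h.symm)
  rw [dotProduct_three]
  nlinarith [mul_self_nonneg (v 0), mul_self_nonneg (v 1), mul_self_nonneg (v 2)]

/-- A rotation takes two linearly independent vectors to `s e₃` and `d₃ e₃ + d₁ e₁`. -/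
theorem exists_rotation_of_cross_ne_zero {v w : Fin 3 → ℝ} (h : v ⨯₃ w ≠ 0) :
    ∃ Q : (Fin 3 → ℝ) ≃ₗ[ℝ] (Fin 3 → ℝ), (∀ x y, Q x ⬝ᵥ Q y = x ⬝ᵥ y) ∧
      (∀ x y, Q (x ⨯₃ y) = Q x ⨯₃ Q y) ∧ (∃ s : ℝ, 0 < s ∧ Q v = s • Pi.single (2 : Fin 3) (1 : ℝ)) ∧
      ∃ d₃ d₁ : ℝ, d₁ ≠ 0 ∧
        Q w = d₃ • Pi.single (2 : Fin 3) (1 : ℝ) + d₁ • Pi.single (0 : Fin 3) (1 : ℝ) := by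
  have hv : v ≠ 0 := by
    rintro rfl
    simp at h
  obtain ⟨a, ha, haa⟩ : ∃ a : ℝ, 0 < a ∧ a * a = v ⬝ᵥ v :=
    ⟨_, Real.sqrt_pos.2 (dotProduct_self_pos hv), Real.mul_self_sqrt (dotProduct_self_pos hv).le⟩
  obtain ⟨b, hb, hbb⟩ : ∃ b : ℝ, 0 < b ∧ b * b = (v ⨯₃ w) ⬝ᵥ (v ⨯₃ w) :=
    ⟨_, Real.sqrt_pos.2 (dotProduct_self_pos h), Real.mul_self_sqrt (dotProduct_self_pos h).le⟩
  set n := v ⨯₃ w with hn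
  have hnv : n ⬝ᵥ v = 0 := by rw [dotProduct_comm, hn, dot_self_cross]
  have hnw : n ⬝ᵥ w = 0 := by rw [dotProduct_comm, hn, dot_cross_self]
  have hvn : v ⬝ᵥ n = 0 := by rw [dotProduct_comm, hnv]
  -- With a = |v| and b = |n|, the last two rows are n/|n| and v/|v|, and the first is their cross
  -- product. Since w ⊥ n, the image of w has no middle component, and its first one is (n ×
  -- v)·w/(ab) = b/a ≠ 0.
  set f : Fin 3 → Fin 3 → ℝ := ![(a⁻¹ * b⁻¹) • n ⨯₃ v, b⁻¹ • n, a⁻¹ • v] with hf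
  have hff : (n ⨯₃ v) ⬝ᵥ (n ⨯₃ v) = a * a * (b * b) := by
    rw [cross_dot_cross, hnv, haa, hbb, hvn]
    ring
  have hnnv : n ⬝ᵥ n ⨯₃ v = 0 := dot_self_cross _ _
  have hvnv : v ⬝ᵥ n ⨯₃ v = 0 := dot_cross_self _ _
  have c1 : n ⨯₃ v ⨯₃ n = (b * b) • v := by
    rw [cross_cross_eq_smul_sub_smul, hvn, ← hbb]
    simp
  have c2 : v ⨯₃ (n ⨯₃ v) = (a * a) • n := by
    rw [← cross_anticomm, cross_cross_eq_smul_sub_smul, hnv, ← haa]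
    simp
  obtain ⟨Q, hQ, hdot, hcross⟩ := exists_rotation_of_frame f (by
    intro i j
    fin_cases i <;> fin_cases j <;>
      simp [hf, hff, hnnv, hvnv, dotProduct_comm (n ⨯₃ v), ← haa, ← hbb, hnv, hvn] <;>
      field_simp)
    (by
      simp only [hf, Matrix.cons_val, map_smul, LinearMap.smul_apply, c1, smul_smul]
      congr 1
      field_simp)
    (by
      simp only [hf, Matrix.cons_val, map_smul, LinearMap.smul_apply, smul_smul])
    (by
      simp only [hf, Matrix.cons_val, map_smul, LinearMap.smul_apply, c2, smul_smul]
      congr 1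
      field_simp)
  have hnvw : (n ⨯₃ v) ⬝ᵥ w = b * b := by
    rw [dotProduct_comm, ← triple_product_permutation, ← triple_product_permutation, hbb, hn]
  refine ⟨Q, hdot, hcross, ⟨a, ha, ?_⟩, f 2 ⬝ᵥ w, f 0 ⬝ᵥ w, ?_, ?_⟩
  · funext i
    rw [hQ]
    fin_cases i
    · simp [hf, dotProduct_comm _ v, hvnv]
    · simp [hf, hnv]
    · simp [hf, ← haa, ha.ne']
  · simp [hf, hnvw, ha.ne', hb.ne']
  · funext i
    rw [hQ]
    fin_cases i
    · simp
    · simp [hf, hnw]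
    · simp

theorem exists_rotation_of_ne_zero {v : Fin 3 → ℝ} (h : v ≠ 0) :
    ∃ Q : (Fin 3 → ℝ) ≃ₗ[ℝ] (Fin 3 → ℝ), (∀ x y, Q x ⬝ᵥ Q y = x ⬝ᵥ y) ∧
      (∀ x y, Q (x ⨯₃ y) = Q x ⨯₃ Q y) ∧ ∃ s : ℝ, 0 < s ∧ Q v = s • Pi.single (2 : Fin 3) (1 : ℝ) := by
  suffices hw : ∃ w, v ⨯₃ w ≠ 0 by
    obtain ⟨w, hw⟩ := hw
    obtain ⟨Q, h1, h2, h3, -⟩ := exists_rotation_of_cross_ne_zero hw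
    exact ⟨Q, h1, h2, h3⟩
  by_contra! hw
  refine h (funext fun i => ?_)
  have e0 := congr_fun (hw (Pi.single 0 1))
  have e1 := congr_fun (hw (Pi.single 1 1))
  have a0 := e0 1
  have a1 := e0 2
  have a2 := e1 2
  simp [cross_apply] at a0 a1 a2
  fin_cases i
  · exact a2
  · exact a1
  · exact a0

/-! ### Normal forms -/

@[simp] theorem Alg.sub_minus (X Y : Alg) : (X - Y).minus = X.minus - Y.minus := by
  simp [sub_eq_add_neg]
@[simp] theorem Alg.sub_plus (X Y : Alg) : (X - Y).plus = X.plus - Y.plus := by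
  simp [sub_eq_add_neg]
@[simp] theorem Alg.sub_cE (X Y : Alg) : (X - Y).cE = X.cE - Y.cE := by
  simp [sub_eq_add_neg]
@[simp] theorem Alg.sub_cEs (X Y : Alg) : (X - Y).cEs = X.cEs - Y.cEs := by
  simp [sub_eq_add_neg]
@[simp] theorem Alg.sub_cV (X Y : Alg) : (X - Y).cV = X.cV - Y.cV := by
  simp [sub_eq_add_neg]

/-! ### The norm of ξ_X and its positivity for the normal forms -/

theorem metric_field (X : Alg) (p t : ℝ) (x : Fin 3 → ℝ) :
    metric (p, t, x) (field X (p, t, x)) (field X (p, t, x)) =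
      2 * X.minus * (X.plus + wave X.cEs X.cE t ⬝ᵥ x) + X.minus ^ 2 * (x ⬝ᵥ x)
        + (wave X.cE X.cEs t + X.cV ⨯₃ x) ⬝ᵥ (wave X.cE X.cEs t + X.cV ⨯₃ x) := by
  rw [field_apply, metric_eq]
  ring

theorem dotProduct_self_nonneg_three (x : Fin 3 → ℝ) : 0 ≤ x ⬝ᵥ x := by
  rw [dotProduct_three]
  nlinarith [mul_self_nonneg (x 0), mul_self_nonneg (x 1), mul_self_nonneg (x 2)]

theorem metric_field_pos_of_wave_ne_zero {X : Alg} {p t : ℝ} {x : Fin 3 → ℝ}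
    (hX : X.minus = 0) (h : wave X.cE X.cEs t + X.cV ⨯₃ x ≠ 0) :
    0 < metric (p, t, x) (field X (p, t, x)) (field X (p, t, x)) := by
  rw [metric_field, hX]
  simpa using dotProduct_self_pos h

theorem cosh_sub_sinh_ne_zero (t : ℝ) : Real.cosh t - Real.sinh t ≠ 0 := by
  rw [Real.cosh_sub_sinh]
  exact (Real.exp_pos _).ne'

theorem cosh_add_sinh_ne_zero (t : ℝ) : Real.cosh t + Real.sinh t ≠ 0 := by
  rw [Real.cosh_add_sinh]
  exact (Real.exp_pos _).ne'

/-- For X₁ the norm is at least 2γ. In all other cases α = 0, and one component of the spatial part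
is nonzero: the third, which a rotation about that axis leaves alone, or for X₉ with x⁻ ≠ 0 the
first. -/
theorem IsNormalForm.metric_pos {X : Alg} (h : IsNormalForm X) (q : CW5) :
    0 < metric q (field X q) (field X q) := by
  obtain ⟨p, t, x⟩ := q
  have key : ∀ {i : Fin 3} {a : ℝ}, a ≠ 0 → (wave X.cE X.cEs t + X.cV ⨯₃ x) i = a →
      wave X.cE X.cEs t + X.cV ⨯₃ x ≠ 0 := fun ha he h0 => ha (by rw [← he, h0]; rfl)
  have hc := (Real.cosh_pos t).ne'
  cases h with
  | X1 b γ hγ =>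
    rw [metric_field]
    have h1 := dotProduct_self_nonneg_three x
    set X := eMinus + b • V 2 + γ • ePlus
    have h2 := dotProduct_self_nonneg_three (wave X.cE X.cEs t + X.cV ⨯₃ x)
    have e1 : X.minus = 1 := by simp [X, eMinus, V, ePlus]
    have e2 : X.plus = γ := by simp [X, eMinus, V, ePlus]
    have e3 : wave X.cEs X.cE t = 0 := by simp [X, eMinus, V, ePlus, wave]
    rw [e1, e2, e3, zero_dotProduct]
    linarith
  | X2 c hc' =>
    refine metric_field_pos_of_wave_ne_zero (by simp [V, e]) (key (i := 2) (mul_ne_zero hc hc') ?_)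
    simp [V, e, wave_apply, cross_apply]
  | X4plus c hc' =>
    refine metric_field_pos_of_wave_ne_zero (by simp [V, e, eStar])
      (key (i := 2) (mul_ne_zero (cosh_sub_sinh_ne_zero t) hc') ?_)
    simp [V, e, eStar, wave_apply, cross_apply, -Real.cosh_sub_sinh, -Real.cosh_add_sinh]
    ring
  | X4minus c hc' =>
    refine metric_field_pos_of_wave_ne_zero (by simp [V, e, eStar])
      (key (i := 2) (mul_ne_zero (cosh_add_sinh_ne_zero t) hc') ?_)
    simp [V, e, eStar, wave_apply, cross_apply, -Real.cosh_sub_sinh, -Real.cosh_add_sinh]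
    ring
  | X6 =>
    refine metric_field_pos_of_wave_ne_zero (by simp [e]) (key (i := 2) hc ?_)
    simp [e, wave_apply]
  | X8plus =>
    refine metric_field_pos_of_wave_ne_zero (by simp [e, eStar])
      (key (i := 2) (cosh_sub_sinh_ne_zero t) ?_)
    simp [e, eStar, wave_apply]
  | X8minus =>
    refine metric_field_pos_of_wave_ne_zero (by simp [e, eStar])
      (key (i := 2) (cosh_add_sinh_ne_zero t) ?_)
    simp [e, eStar, wave_apply]
  | X9 d₃ d₁ hd₁ =>
    refine metric_field_pos_of_wave_ne_zero (by simp [e, eStar]) ?_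
    rcases eq_or_ne t 0 with rfl | ht
    · refine key (i := 2) one_ne_zero ?_
      simp [e, eStar, wave_apply]
    · refine key (i := 0) (neg_ne_zero.2 (mul_ne_zero (Real.sinh_ne_zero.2 ht) hd₁)) ?_
      simp [e, eStar, wave_apply]

theorem field_smul (r : ℝ) (X : Alg) : field (r • X) = r • field X := by
  funext ⟨p, t, x⟩
  simp only [field_apply, Pi.smul_apply]
  refine Prod.ext ?_ (Prod.ext ?_ ?_)
  · simp [dotProduct_three, wave_apply]
    ring
  · simp
  · funext i
    simp [wave_apply]
    ring

/-- The field `ξ_X` vanishes nowhere in norm. -/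
def NormNeZero (X : Alg) : Prop := ∀ p, metric p (field X p) (field X p) ≠ 0

/-- The field `ξ_X` is isometric to a nonzero multiple of a normal form. -/
def HasNormalForm (X : Alg) : Prop :=
  ∃ (r : ℝ) (Y : Alg), r ≠ 0 ∧ IsNormalForm Y ∧ Related (field X) (r • field Y)

theorem HasNormalForm.of_related {X Y : Alg} (h : Related (field X) (field Y))
    (hY : HasNormalForm Y) : HasNormalForm X := by
  obtain ⟨r, Z, hr, hZ, hYZ⟩ := hY
  exact ⟨r, Z, hr, hZ, h.trans hYZ⟩

theorem HasNormalForm.smul {X : Alg} (h : HasNormalForm X) {r : ℝ} (hr : r ≠ 0) :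
    HasNormalForm (r • X) := by
  obtain ⟨s, Z, hs, hZ, hXZ⟩ := h
  refine ⟨r * s, Z, mul_ne_zero hr hs, hZ, ?_⟩
  rw [field_smul, mul_smul]
  exact hXZ.smul r

theorem IsNormalForm.hasNormalForm {X : Alg} (h : IsNormalForm X) : HasNormalForm X :=
  ⟨1, X, one_ne_zero, h, by rw [one_smul]; exact Related.refl _⟩

theorem NormNeZero.of_smul {X : Alg} {r : ℝ} (h : NormNeZero (r • X)) : NormNeZero X := by
  intro p hp
  refine h p ?_
  rw [field_smul]
  have : metric p ((r • field X) p) ((r • field X) p) = r ^ 2 * metric p (field X p) (field X p) := by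
    simp only [metric_eq, Pi.smul_apply, Prod.smul_fst, Prod.smul_snd, smul_dotProduct,
      dotProduct_smul, smul_eq_mul]
    ring
  rw [this, hp, mul_zero]

/-- The third basis vector of `ℝ³`. -/
abbrev axis : Fin 3 → ℝ := Pi.single 2 1

theorem axis_dotProduct_axis : axis ⬝ᵥ axis = 1 := by simp

/-! ### Reduction to the normal forms, case by case -/

theorem hasNormalForm_of_minus_eq_one {γ : ℝ} {c d b : Fin 3 → ℝ}
    (h : NormNeZero ⟨1, γ, c, d, b⟩) : HasNormalForm ⟨1, γ, c, d, b⟩ := by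
  -- Taking v = c - b × u removes c; removing d as well requires u - b × (b × u) = d - b × c =: w.
  -- Pairing with b gives b·u = b·w, whence the explicit solution.
  obtain ⟨u, hu⟩ : ∃ u, d - b ⨯₃ (c - b ⨯₃ u) - u = 0 := by
    have hb : 1 + b ⬝ᵥ b ≠ 0 := by
      have := dotProduct_self_nonneg_three b
      positivity
    set w := d - b ⨯₃ c with hw
    refine ⟨(1 + b ⬝ᵥ b)⁻¹ • (w + (b ⬝ᵥ w) • b), ?_⟩
    rw [map_sub, cross_cross_eq_smul_sub_smul', ← sub_add, ← hw]
    funext i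
    simp only [dotProduct_smul, dotProduct_add, Pi.add_apply, Pi.sub_apply, Pi.smul_apply,
      smul_eq_mul, Pi.zero_apply]
    field_simp
    ring
  have h1 := related_heisenberg ⟨1, γ, c, d, b⟩ u (c - b ⨯₃ u)
  simp only [one_smul, sub_self, hu] at h1
  refine HasNormalForm.of_related h1 ?_
  have h := h1.norm_ne_zero h
  clear h1
  revert h
  generalize γ + _ - _ + _ + _ = γ'
  intro h
  obtain ⟨Q, hdot, hcross, s, hs⟩ : ∃ Q : (Fin 3 → ℝ) ≃ₗ[ℝ] (Fin 3 → ℝ),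
      (∀ x y, Q x ⬝ᵥ Q y = x ⬝ᵥ y) ∧ (∀ x y, Q (x ⨯₃ y) = Q x ⨯₃ Q y) ∧ ∃ s : ℝ, Q b = s • axis := by
    rcases eq_or_ne b 0 with rfl | hb
    · exact ⟨LinearEquiv.refl ℝ _, by simp, by simp, 0, by simp⟩
    · obtain ⟨Q, h1, h2, s, -, hs⟩ := exists_rotation_of_ne_zero hb
      exact ⟨Q, h1, h2, s, hs⟩
  have h1 := related_rotation ⟨1, γ', 0, 0, b⟩ Q hdot hcross
  simp only [map_zero, hs] at h1
  refine HasNormalForm.of_related h1 ?_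
  have h := h1.norm_ne_zero h
  -- On the axis of rotation the norm is 2γ' + |x|², which has a zero if γ' ≤ 0.
  have hγ : 0 < γ' := by
    by_contra! hγ
    refine h (0, 0, √(-2 * γ') • axis) ?_
    have h2 : √(-2 * γ') * √(-2 * γ') = -2 * γ' := Real.mul_self_sqrt (by linarith)
    rw [metric_field]
    simp only [wave, smul_zero, sub_self, zero_dotProduct, map_smul, LinearMap.smul_apply,
      cross_self, add_zero, dotProduct_smul, smul_dotProduct, axis_dotProduct_axis,
      smul_eq_mul, mul_one, h2]
    ring
  have e : (⟨1, γ', 0, 0, s • axis⟩ : Alg) = eMinus + s • V 2 + γ' • ePlus := by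
    ext <;> simp [eMinus, V, ePlus]
  rw [e]
  exact (IsNormalForm.X1 s γ' hγ).hasNormalForm

/-- The equation coth t = k amounts to exp(2t) = (k + 1)/(k - 1), which is positive exactly when |k|
> 1. -/
theorem exists_cosh_eq_mul_sinh {k : ℝ} (hk : 1 < k ^ 2) :
    ∃ t, Real.cosh t - k * Real.sinh t = 0 := by
  have h1 : 0 < (k + 1) / (k - 1) := by
    have : 0 < (k + 1) * (k - 1) := by nlinarith
    have h : k - 1 ≠ 0 := by
      rintro h
      rw [h] at this
      simp at this
    have h' : 0 < (k - 1) ^ 2 := by positivity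
    have e : (k + 1) / (k - 1) = (k + 1) * (k - 1) / (k - 1) ^ 2 := by field_simp
    rw [e]
    positivity
  have h2 : k - 1 ≠ 0 := by
    rintro h
    simp [h] at h1
  refine ⟨Real.log ((k + 1) / (k - 1)) / 2, ?_⟩
  set t := Real.log ((k + 1) / (k - 1)) / 2 with ht
  have h3 : Real.exp t * Real.exp t = (k + 1) / (k - 1) := by
    rw [← Real.exp_add, ht, add_halves, Real.exp_log h1]
  have h4 : Real.exp t * Real.exp (-t) = 1 := by rw [← Real.exp_add, add_neg_cancel, Real.exp_zero]
  rw [eq_div_iff h2] at h3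
  rw [Real.cosh_eq, Real.sinh_eq]
  have h5 : Real.exp t ≠ 0 := (Real.exp_pos t).ne'
  refine (mul_eq_zero.1 ?_).resolve_left h5
  linear_combination (1 / 2 + k / 2) * h4 - h3 / 2

theorem exists_sinh_eq_mul_cosh {k : ℝ} (hk : k ^ 2 < 1) :
    ∃ t, Real.sinh t + k * Real.cosh t = 0 := by
  rcases eq_or_ne k 0 with rfl | h0
  · exact ⟨0, by simp⟩
  obtain ⟨t, ht⟩ := exists_cosh_eq_mul_sinh (k := -k⁻¹) (by
    rw [neg_sq, inv_pow]
    exact (one_lt_inv₀ (by positivity)).2 hk)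
  refine ⟨t, ?_⟩
  field_simp at ht
  linear_combination ht

/-- If `c` and `d` are parallel to the axis, a boost achieves `d = 0` or `d = ±c`. -/
theorem exists_related_of_parallel {c k β : ℝ} (hc : c ≠ 0)
    (h : NormNeZero ⟨0, 0, c • axis, (k * c) • axis, β • axis⟩) :
    ∃ c' d' : ℝ, c' ≠ 0 ∧ (d' = 0 ∨ d' = c' ∨ d' = -c') ∧
      Related (field ⟨0, 0, c • axis, (k * c) • axis, β • axis⟩)
        (field ⟨0, 0, c' • axis, d' • axis, β • axis⟩) := by
  -- For |k| < 1 a boost removes d, for |k| = 1 nothing is to be done, and for |k| > 1 the field has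
  -- zero norm at a point with x = 0.
  rcases lt_trichotomy (k ^ 2) 1 with hk | hk | hk
  · obtain ⟨s, hs⟩ := exists_sinh_eq_mul_cosh hk
    have h1 := related_boost ⟨0, 0, c • axis, (k * c) • axis, β • axis⟩ s
    simp only [smul_smul, ← add_smul] at h1
    refine ⟨_, _, ?_, Or.inl ?_, h1⟩
    · have hne : Real.cosh s + Real.sinh s * k ≠ 0 := by
        intro h0
        have e := Real.cosh_sq s
        have : (1 : ℝ) = 0 := by
          linear_combination Real.cosh s * h0 - Real.sinh s * hs - e
        exact one_ne_zero this
      intro h0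
      refine mul_ne_zero hne hc ?_
      linear_combination h0
    · linear_combination c * hs
  · refine ⟨c, k * c, hc, Or.inr ?_, Related.refl _⟩
    rcases sq_eq_one_iff.1 hk with h | h <;> simp [h]
  · obtain ⟨t, ht⟩ := exists_cosh_eq_mul_sinh hk
    refine absurd ?_ (h (0, t, 0))
    have e : wave (c • axis) ((k * c) • axis) t = 0 := by
      rw [wave, smul_smul, smul_smul, ← sub_smul]
      have : Real.cosh t * c - Real.sinh t * (k * c) = 0 := by linear_combination c * ht
      rw [this, zero_smul]
    rw [metric_field]
    simp [e]

theorem hasNormalForm_of_minus_eq_zero_of_rot_eq_zero {γ : ℝ} {c d : Fin 3 → ℝ}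
    (h : NormNeZero ⟨0, γ, c, d, 0⟩) : HasNormalForm ⟨0, γ, c, d, 0⟩ := by
  have hc : c ≠ 0 := by
    rintro rfl
    refine h (0, 0, 0) ?_
    rw [metric_field]
    simp [wave]
  have hcc := dotProduct_self_pos hc
  -- With α = 0 and b = 0 the Heisenberg group fixes c and d and shifts γ by v·c - u·d; this v
  -- cancels γ.
  have h1 := related_heisenberg ⟨0, γ, c, d, 0⟩ 0 (-(γ / (c ⬝ᵥ c)) • c)
  have e0 : γ + -(γ / (c ⬝ᵥ c) * c ⬝ᵥ c) = 0 := by field_simp; ring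
  simp [e0] at h1
  refine HasNormalForm.of_related h1 ?_
  have h := h1.norm_ne_zero h
  clear h1 e0
  by_cases hcd : c ⨯₃ d = 0
  · obtain ⟨k, rfl⟩ : ∃ k : ℝ, d = k • c := by
      have e := cross_cross_eq_smul_sub_smul' c c d
      rw [hcd, map_zero] at e
      refine ⟨(c ⬝ᵥ d) / (c ⬝ᵥ c), ?_⟩
      rw [div_eq_inv_mul, mul_smul, sub_eq_zero.1 e.symm, smul_smul, inv_mul_cancel₀ hcc.ne',
        one_smul]
    obtain ⟨Q, hdot, hcross, s, hs, hQ⟩ := exists_rotation_of_ne_zero hc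
    have h1 := related_rotation ⟨0, 0, c, k • c, 0⟩ Q hdot hcross
    simp only [map_smul, map_zero, hQ, smul_smul] at h1
    refine HasNormalForm.of_related h1 ?_
    have h := h1.norm_ne_zero h
    clear h1
    -- Puts the vanishing rotation part in the form β • `axis` with β = 0.
    rw [← zero_smul ℝ axis] at h ⊢
    obtain ⟨c', d', hc', hd', h1⟩ := exists_related_of_parallel hs.ne' h
    refine HasNormalForm.of_related h1 ?_
    rcases hd' with rfl | rfl | rfl
    · have e : (⟨0, 0, c' • axis, (0 : ℝ) • axis, (0 : ℝ) • axis⟩ : Alg) = c' • e 2 := by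
        ext <;> simp [e]
      rw [e]
      exact IsNormalForm.X6.hasNormalForm.smul hc'
    · have e : (⟨0, 0, d' • axis, d' • axis, (0 : ℝ) • axis⟩ : Alg) = d' • (e 2 + eStar 2) := by
        ext <;> simp [e, eStar]
      rw [e]
      exact IsNormalForm.X8plus.hasNormalForm.smul hc'
    · have e : (⟨0, 0, c' • axis, -c' • axis, (0 : ℝ) • axis⟩ : Alg)
          = c' • (e 2 - eStar 2) := by
        ext <;> simp [e, eStar]
      rw [e]
      exact IsNormalForm.X8minus.hasNormalForm.smul hc'
  · obtain ⟨Q, hdot, hcross, ⟨s, hs, hQ⟩, d₃, d₁, hd₁, hQ'⟩ := exists_rotation_of_cross_ne_zero hcd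
    have h1 := related_rotation ⟨0, 0, c, d, 0⟩ Q hdot hcross
    simp only [map_zero, hQ, hQ'] at h1
    refine HasNormalForm.of_related h1 ?_
    have e : (⟨0, 0, s • axis, d₃ • axis + d₁ • Pi.single (0 : Fin 3) (1 : ℝ), 0⟩ : Alg)
        = s • (e 2 + (d₃ / s) • eStar 2 + (d₁ / s) • eStar 0) := by
      ext i <;> simp [e, eStar]
      field_simp
    rw [e]
    exact (IsNormalForm.X9 _ _ (div_ne_zero hd₁ hs.ne')).hasNormalForm.smul hs.ne'

theorem hasNormalForm_of_rot_eq_axis {γ : ℝ} {c d : Fin 3 → ℝ}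
    (h : NormNeZero ⟨0, γ, c, d, axis⟩) : HasNormalForm ⟨0, γ, c, d, axis⟩ := by
  have hp : ∀ w : Fin 3 → ℝ, w - axis ⨯₃ ![w 1, -w 0, 0] = w 2 • axis := fun w => by
    funext i
    fin_cases i <;> simp [cross_apply, axis]
  -- The cross product with the axis is invertible on the orthogonal plane, so u and v can cancel
  -- the parts of c and d in that plane.
  have h1 := related_heisenberg ⟨0, γ, c, d, axis⟩ ![c 1, -c 0, 0] ![d 1, -d 0, 0]
  simp only [zero_smul, sub_zero, hp] at h1
  refine HasNormalForm.of_related h1 ?_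
  have h := h1.norm_ne_zero h
  clear h1
  revert h
  generalize γ + _ - _ + _ + _ = γ'
  generalize c 2 = c₃
  generalize d 2 = d₃
  intro h
  have hc : c₃ ≠ 0 := by
    rintro rfl
    refine h (0, 0, 0) ?_
    rw [metric_field]
    simp [wave]
  -- A v along the axis is annihilated by the cross product, so it leaves c and d unchanged and only
  -- cancels γ'.
  have h1 := related_heisenberg ⟨0, γ', c₃ • axis, d₃ • axis, axis⟩ 0 (-(γ' / c₃) • axis)
  have e0 : γ' + c₃ * -(γ' / c₃) = 0 := by field_simp; ring
  simp only [map_smul, cross_self, smul_zero, map_zero, zero_smul, sub_zero, zero_dotProduct,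
    dotProduct_zero, add_zero, zero_mul, zero_div, smul_dotProduct, dotProduct_smul,
    axis_dotProduct_axis, smul_eq_mul, mul_one, mul_zero, e0] at h1
  refine HasNormalForm.of_related h1 ?_
  have h := h1.norm_ne_zero h
  clear h1 e0
  have ed : d₃ = d₃ / c₃ * c₃ := by field_simp
  have ea : (⟨0, 0, c₃ • axis, d₃ • axis, axis⟩ : Alg)
      = ⟨0, 0, c₃ • axis, (d₃ / c₃ * c₃) • axis, (1 : ℝ) • axis⟩ := by rw [← ed, one_smul]
  rw [ea] at h ⊢
  obtain ⟨c', d', hc', hd', h1⟩ := exists_related_of_parallel hc h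
  refine HasNormalForm.of_related h1 ?_
  rcases hd' with rfl | rfl | rfl
  · have e : (⟨0, 0, c' • axis, (0 : ℝ) • axis, (1 : ℝ) • axis⟩ : Alg) = V 2 + c' • e 2 := by
      ext <;> simp [e, V]
    rw [e]
    exact (IsNormalForm.X2 c' hc').hasNormalForm
  · have e : (⟨0, 0, d' • axis, d' • axis, (1 : ℝ) • axis⟩ : Alg)
        = V 2 + d' • (e 2 + eStar 2) := by
      ext <;> simp [e, eStar, V]
    rw [e]
    exact (IsNormalForm.X4plus d' hc').hasNormalForm
  · have e : (⟨0, 0, c' • axis, -c' • axis, (1 : ℝ) • axis⟩ : Alg)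
        = V 2 + c' • (e 2 - eStar 2) := by
      ext <;> simp [e, eStar, V]
    rw [e]
    exact (IsNormalForm.X4minus c' hc').hasNormalForm

theorem NormNeZero.hasNormalForm {X : Alg} (h : NormNeZero X) : HasNormalForm X := by
  obtain ⟨α, γ, c, d, b⟩ := X
  rcases eq_or_ne α 0 with rfl | hα
  · rcases eq_or_ne b 0 with rfl | hb
    · exact hasNormalForm_of_minus_eq_zero_of_rot_eq_zero h
    · obtain ⟨Q, hdot, hcross, s, hs, hQ⟩ := exists_rotation_of_ne_zero hb
      have h1 := related_rotation ⟨0, γ, c, d, b⟩ Q hdot hcross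
      refine HasNormalForm.of_related h1 ?_
      have h := h1.norm_ne_zero h
      have e : (⟨0, γ, Q c, Q d, Q b⟩ : Alg)
          = s • ⟨0, s⁻¹ * γ, s⁻¹ • Q c, s⁻¹ • Q d, axis⟩ := by
        ext <;> simp [hs.ne', hQ]
      simp only [e] at h ⊢
      exact (hasNormalForm_of_rot_eq_axis (NormNeZero.of_smul h)).smul hs.ne'
  · have e : (⟨α, γ, c, d, b⟩ : Alg) = α • ⟨1, α⁻¹ * γ, α⁻¹ • c, α⁻¹ • d, α⁻¹ • b⟩ := by
      ext <;> simp [hα]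
    rw [e] at h ⊢
    exact (hasNormalForm_of_minus_eq_one (NormNeZero.of_smul h)).smul hα

end CW

theorem proposition5p1 :
    (∀ ξ : CW.CW5 → CW.CW5, CW.IsKilling ξ → (∀ p : CW.CW5, CW.metric p (ξ p) (ξ p) ≠ 0) →
      ∃ φ : CW.CW5 ≃ CW.CW5, CW.IsIsometry φ ∧
        ∃ (r : ℝ) (X : CW.Alg), r ≠ 0 ∧ CW.IsNormalForm X ∧
          CW.pushforward φ ξ = r • CW.field X) ∧
    (∀ X : CW.Alg, CW.IsNormalForm X →
      CW.IsKilling (CW.field X) ∧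
        ∀ p : CW.CW5, 0 < CW.metric p (CW.field X p) (CW.field X p)) := by
  refine ⟨fun ξ hξ hn => ?_, fun X hX => ⟨CW.isKilling_field X, hX.metric_pos⟩⟩
  obtain ⟨Z, rfl⟩ := hξ.exists_eq_field
  obtain ⟨r, X, hr, hX, h⟩ := CW.NormNeZero.hasNormalForm hn
  obtain ⟨φ, hφ, h⟩ := h.exists_pushforward
  exact ⟨φ, hφ, r, X, hr, hX, h⟩
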